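/- Formulas are built from variables $p_0,p_1,\dots$ by $\wedge,\vee,\supset,\neg$. For $k\ge 2$, $k$-valued Łukasiewicz logic Ł$_k$ has the truth values $0,\frac1{k-1},\dots,\frac{k-2}{k-1},1$ with $v(\neg A)=1-v(A)$, $v(A\wedge B)=\min(v(A),v(B))$, $v(A\vee B)=\max(v(A),v(B))$, $v(A\supset B)=\min(1,1-v(A)+v(B))$, and $\Gamma\vDash B$ means that every valuation giving value $1$ to all members of $\Gamma$ gives value $1$ to $B$. Let $\mathcal H_k$ (written $\mathcal H$Łuk$_k$) be any Frege system for Ł$_k$: finitely many axiom schemas, with modus ponens as the only rule, that are sound and implicationally complete for Ł$_k$ (for finite $\Gamma$, $\Gamma\vDash B$ implies that $B$ is derivable from $\Gamma$). A proof of $A$ in $\mathcal H_k$ is a finite sequence of formulas ending in $A$, each of which is an instance of an axiom schema or follows by modus ponens from two earlier ones; the number of its steps is the length of the sequence. The nested system Ł$_{k_{n\vee}}$ is $\mathcal H_k$ augmented with nested disjunction elimination. Its proofs are sequences of sequents $\Gamma_i\Rightarrow A_i$, where $\Gamma_i$ is the finite sequence of the assumptions open at step $i$ (none before the first step), and each step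 is one of the following. (a) $A_i$ is an axiom of $\mathcal H_k$ and $\Gamma_i=\Gamma_{i-1}$. (b) $A_i$ follows by modus ponens from two available sequents and $\Gamma_i=\Gamma_{i-1}$. (c) An assumption $A_i$ is opened: $\Gamma_i=\Gamma*\langle A_i\rangle$, where $\Gamma$ is the context of the last available sequent. (d) From an available sequent $A\vee B$ and two consecutive blocks, one running from the opening of $A$ over $\Gamma$ to $\Gamma*\langle A\rangle\Rightarrow C$ and the other from the opening of $B$ over $\Gamma$ to $\Gamma*\langle B\rangle\Rightarrow C$, infer $\Gamma\Rightarrow C$ in the next step. The assumption of a block is closed at the step after its last sequent, and the sequents of the block are not available from then on; all other earlier sequents are available. Every block opened is used in this way. A proof of $A$ ends in the sequent $\Rightarrow A$ with no open assumptions, and the number of its steps is the number of sequents. Let $A(0,x)=2x$, $A(i+1,0)=1$, $A(i+1,x+1)=A(i,A(i+1,x))$ be the Ackermann function, and let $\alpha(n)$ be the least $i$ with $n\le A(i,i)$. Let $\log^{(*0)}n$ be the integer part of $\log_2 n$ for $n\ge1$ (and $0$ for $n=0$), and let $\log^{(*(i+1))}n$ be the least number of iterations of $\log^{(*i)}$ that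 takes $n$ to a value less than $2$. **Theorem.** Let $k\ge2$ and let $\mathcal H_k$ be a Frege system for Ł$_k$ as above. (1) There is a constant $c$, depending only on $k$ and $\mathcal H_k$, such that if $A$ has an Ł$_{k_{n\vee}}$-proof in $n$ steps, then $A$ has an $\mathcal H_k$-proof in at most $c\cdot n\cdot\alpha(n)$ steps. (2) For every $i\ge0$ there is a constant $c$, depending only on $k$, $\mathcal H_k$ and $i$, such that if $A$ has an Ł$_{k_{n\vee}}$-proof in $n$ steps in which assumptions are opened $m$ times, then $A$ has an $\mathcal H_k$-proof in at most $c\,(n+m\log^{(*i)}m)$ steps, and, if $m\ge2$, this same proof also has at most $c\cdot n\cdot m\log^{(*i)}m$ steps. -/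

import Mathlib

namespace LukNested

/-- Propositional formulas over `∧, ∨, ⊃, ¬` with variables `p₀, p₁, …`. -/
inductive Formula : Type
  | var : ℕ → Formula
  | conj : Formula → Formula → Formula
  | disj : Formula → Formula → Formula
  | imp : Formula → Formula → Formula
  | neg : Formula → Formula

/-- Simultaneous substitution of formulas for variables. -/
def Formula.subst (σ : ℕ → Formula) : Formula → Formula
  | .var p => σ p
  | .conj A B => .conj (A.subst σ) (B.subst σ)
  | .disj A B => .disj (A.subst σ) (B.subst σ)
  | .imp A B => .imp (A.subst σ) (B.subst σ)
  | .neg A => .neg (A.subst σ)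

/-- The Łukasiewicz truth functions. -/
def Formula.eval (v : ℕ → ℚ) : Formula → ℚ
  | .var p => v p
  | .conj A B => min (A.eval v) (B.eval v)
  | .disj A B => max (A.eval v) (B.eval v)
  | .imp A B => min 1 (1 - A.eval v + B.eval v)
  | .neg A => 1 - A.eval v

/-- A `k`-valued valuation takes values in `{0, 1/(k-1), …, (k-2)/(k-1), 1}`. -/
def IsValuation (k : ℕ) (v : ℕ → ℚ) : Prop :=
  ∀ p, ∃ j : ℕ, j < k ∧ v p = (j : ℚ) / ((k : ℚ) - 1)

/-- `Γ ⊨ B` in `k`-valued Łukasiewicz logic: `B` takes value `1` under every `k`-valued valuation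
under which all members of `Γ` take value `1`. -/
def Entails (k : ℕ) (Γ : Set Formula) (B : Formula) : Prop :=
  ∀ v : ℕ → ℚ, IsValuation k v → (∀ A ∈ Γ, A.eval v = 1) → B.eval v = 1

/-- Instances of the schemas in `Sch`; the variables of a schema serve as metavariables. -/
def IsAxiom (Sch : Finset Formula) (B : Formula) : Prop :=
  ∃ S ∈ Sch, ∃ σ : ℕ → Formula, B = S.subst σ

/-- A Hilbert-style derivation from `Γ`: every member `B` of the sequence is an axiom, a member of
`Γ`, or is obtained by modus ponens from two formulas that precede it in the sequence. -/
def IsDerivation (Sch : Finset Formula) (Γ : Set Formula) (L : List Formula) : Prop :=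
  ∀ (L₁ : List Formula) (B : Formula) (L₂ : List Formula), L = L₁ ++ B :: L₂ →
    IsAxiom Sch B ∨ B ∈ Γ ∨ ∃ A ∈ L₁, Formula.imp A B ∈ L₁

/-- `B` is derived from `Γ` in exactly `n` steps. -/
def DerivesIn (Sch : Finset Formula) (Γ : Set Formula) (B : Formula) (n : ℕ) : Prop :=
  ∃ L : List Formula, IsDerivation Sch Γ L ∧ L.getLast? = some B ∧ L.length = n

/-- `A` has a proof in exactly `n` steps, that is, a derivation from no hypotheses. -/
def ProvesIn (Sch : Finset Formula) (A : Formula) (n : ℕ) : Prop :=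
  DerivesIn Sch ∅ A n

/-- Finitely many axiom schemas that, with modus ponens as the only rule of inference, form a
Frege system for `k`-valued Łukasiewicz logic: sound and implicationally complete. -/
structure IsFregeSystem (k : ℕ) (Sch : Finset Formula) : Prop where
  sound : ∀ (Γ : Set Formula) (B : Formula) (n : ℕ), DerivesIn Sch Γ B n → Entails k Γ B
  complete : ∀ (Γ : Set Formula) (B : Formula), Γ.Finite → Entails k Γ B →
    ∃ n, DerivesIn Sch Γ B n

/-- A sequent `ctx ⇒ fm`; `ctx` is the finite sequence of the open assumptions, the one opened
last being at the end. -/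
structure Sequent : Type where
  ctx : List Formula
  fm : Formula

/-- `NestedSegment Sch Γ Δ s Δ' m`: at a point of a nested proof where `Γ` is the sequence of open
assumptions and `Δ` consists of the formulas of the sequents that are available, the proof may be
continued by the sequents of `s`, in this order; after that the sequence of open assumptions is `Γ`
again, `Δ'` consists of the formulas of the sequents that are then available, and assumptions
have been opened `m` times in `s`.

In the rule `orElim` the assumption `A` is opened, its block ends in `Γ * ⟨A⟩ ⇒ C`, the next step
closes `A` and opens `B`, whose block ends in `Γ * ⟨B⟩ ⇒ C`, and the next step closes `B` and
states `Γ ⇒ C`; the sequents of the two blocks are not available afterwards. The block of the right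
disjunct is allowed to precede that of the left one. -/
inductive NestedSegment (Sch : Finset Formula) :
    List Formula → Set Formula → List Sequent → Set Formula → ℕ → Prop
  | nil (Γ : List Formula) (Δ : Set Formula) : NestedSegment Sch Γ Δ [] Δ 0
  | ax {Γ : List Formula} {Δ Δ' : Set Formula} {s : List Sequent} {m : ℕ} {A : Formula} :
      NestedSegment Sch Γ Δ s Δ' m →
      IsAxiom Sch A →
      NestedSegment Sch Γ Δ (s ++ [⟨Γ, A⟩]) (insert A Δ') m
  | mp {Γ : List Formula} {Δ Δ' : Set Formula} {s : List Sequent} {m : ℕ} {A B : Formula} :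
      NestedSegment Sch Γ Δ s Δ' m →
      A ∈ Δ' →
      Formula.imp A B ∈ Δ' →
      NestedSegment Sch Γ Δ (s ++ [⟨Γ, B⟩]) (insert B Δ') m
  | orElim {Γ : List Formula} {Δ Δ' Δ₁ Δ₂ : Set Formula} {s s₁ s₂ : List Sequent}
      {m m₁ m₂ : ℕ} {A B C : Formula} :
      NestedSegment Sch Γ Δ s Δ' m →
      Formula.disj A B ∈ Δ' ∨ Formula.disj B A ∈ Δ' →
      NestedSegment Sch (Γ ++ [A]) (insert A Δ') s₁ Δ₁ m₁ →
      (⟨Γ ++ [A], A⟩ :: s₁).getLast? = some ⟨Γ ++ [A], C⟩ →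
      NestedSegment Sch (Γ ++ [B]) (insert B Δ') s₂ Δ₂ m₂ →
      (⟨Γ ++ [B], B⟩ :: s₂).getLast? = some ⟨Γ ++ [B], C⟩ →
      NestedSegment Sch Γ Δ
        (s ++ (⟨Γ ++ [A], A⟩ :: s₁) ++ (⟨Γ ++ [B], B⟩ :: s₂) ++ [⟨Γ, C⟩])
        (insert C Δ') (m + (1 + m₁) + (1 + m₂))

/-- `A` has a proof with `n` steps in the Frege system with axiom schemas `Sch` augmented by the
nested disjunction elimination rule, in which assumptions are opened `m` times. -/
def NestedProvesIn (Sch : Finset Formula) (A : Formula) (n m : ℕ) : Prop :=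
  ∃ (s : List Sequent) (Δ : Set Formula),
    NestedSegment Sch [] ∅ s Δ m ∧ s.getLast? = some ⟨[], A⟩ ∧ s.length = n

/-- The Ackermann function with `A(0,x) = 2x`, `A(i+1,0) = 1`, `A(i+1,x+1) = A(i,A(i+1,x))`. -/
def ackermann : ℕ → ℕ → ℕ
  | 0, x => 2 * x
  | _ + 1, 0 => 1
  | i + 1, x + 1 => ackermann i (ackermann (i + 1) x)

/-- The inverse Ackermann function: the least `i` with `n ≤ A(i,i)`. -/
noncomputable def alpha (n : ℕ) : ℕ := sInf {i | n ≤ ackermann i i}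

/-- `logStar i` is `log^{(*i)}`: `log^{(*0)}` is the (integer part of the) binary logarithm, and
`log^{(*(i+1))} n` is the least number of iterations of `log^{(*i)}` that takes `n` below `2`. -/
noncomputable def logStar : ℕ → ℕ → ℕ
  | 0, n => Nat.log 2 n
  | i + 1, n => sInf {t | (logStar i)^[t] n < 2}

theorem lt_ackermann_succ (i x : ℕ) : x < ackermann (i + 1) x := by
  induction i generalizing x with
  | zero =>
    induction x with
    | zero => simp [ackermann]
    | succ x ih => simp only [ackermann] at ih ⊢; omega
  | succ i ihi =>
    induction x with
    | zero => simp [ackermann]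
    | succ x ih =>
      have := ihi (ackermann (i + 1 + 1) x)
      simp only [ackermann] at ih this ⊢
      omega

/-- The minimum in the definition of `alpha` is attained. -/
theorem le_ackermann_alpha (n : ℕ) : n ≤ ackermann (alpha n) (alpha n) :=
  Nat.sInf_mem (s := {i | n ≤ ackermann i i})
    ⟨n + 1, by have := lt_ackermann_succ n (n + 1); simp only [Set.mem_ofPred_eq]; omega⟩

theorem exists_iterate_lt_two {f : ℕ → ℕ} (hf : ∀ n, 2 ≤ n → f n < n) (n : ℕ) :
    ∃ t, t ≤ n - 1 ∧ f^[t] n < 2 := by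
  induction n using Nat.strong_induction_on with
  | _ n ih =>
    by_cases h : n < 2
    · exact ⟨0, by omega, h⟩
    · have h1 := hf n (by omega)
      obtain ⟨t, ht, ht2⟩ := ih (f n) h1
      exact ⟨t + 1, by omega, ht2⟩

theorem logStar_lt (i n : ℕ) (hn : 2 ≤ n) : logStar i n < n := by
  induction i generalizing n with
  | zero => exact Nat.log_lt_self 2 (by omega)
  | succ i ih =>
    obtain ⟨t, ht, ht2⟩ := exists_iterate_lt_two ih n
    have : logStar (i + 1) n ≤ t := Nat.sInf_le ht2
    omega

/-- The minimum in the definition of `logStar` is attained. -/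
theorem iterate_logStar_lt_two (i n : ℕ) : (logStar i)^[logStar (i + 1) n] n < 2 := by
  obtain ⟨t, -, ht⟩ := exists_iterate_lt_two (logStar_lt i) n
  exact Nat.sInf_mem (s := {t | (logStar i)^[t] n < 2}) ⟨t, ht⟩

end LukNested

/-! Read a sequent `Γ ⇒ A` as the single formula `strongImp k (ctxFormula Γ) A`. The plain
implication of Ł_k has no deduction theorem, but the `(k-1)`-fold one takes value 1 exactly when
value 1 passes from premise to conclusion, because any value below 1 misses 1 by at least `1/(k-1)`.
Hence every rule of the nested system becomes a sound inference between such formulas, and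
completeness together with substitution makes each of them cost a constant number of Frege steps
(`RuleCosts`).

The one real expense is that modus ponens and disjunction elimination may use sequents from an
earlier context `Γ₁`, a prefix of the current `Γ`. Moving them requires `⋀Γ → ⋀Γ₁`, and the two
contexts may be far apart. The contexts form a forest under the prefix order with at most `m`
non-root nodes, so the question is how many transitivity steps, starting from the implications
between neighbours, give a set of shortcuts by which every ancestor is reached in few steps.

`hasShortcuts_logStar` answers it: `O(i · m · log^{(*i)} m)` transitivity steps give paths of length
at most `3 + 2i`. The step from `i` to `i + 1` (`HasShortcuts.step`) cuts the forest at a sparse set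
`S`, uses level `i` on `S`, links every node with its nearby members of `S`, and recurses in the
pieces. Part (2) follows with `i` fixed. Part (1) takes `i = α(n)`, for which `log^{(*i)} n ≤ 4`. -/

namespace LukNested

/-! ### Counting applications of a rule -/

/-- From the available set `X` all members of `Y` can be obtained by at most `K` applications of
the rule `R`. -/
inductive Gen {α : Type*} (R : Set α → α → Prop) (X : Set α) : Set α → ℕ → Prop
  | base {Y : Set α} {K : ℕ} : Y ⊆ X → Gen R X Y K
  | step {Y Z : Set α} {K : ℕ} {b : α} :
      Gen R X Y K → R Y b → Z ⊆ insert b Y → Gen R X Z (K + 1)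

namespace Gen

variable {α : Type*} {R : Set α → α → Prop} {X X' Y Z W : Set α} {K K' : ℕ}

theorem mono (h : Gen R X Y K) (hZ : Z ⊆ Y) : Gen R X Z K := by
  cases h with
  | base h => exact .base (hZ.trans h)
  | step h hb hY => exact .step h hb (hZ.trans hY)

theorem mono_cost (h : Gen R X Y K) (hK : K ≤ K') : Gen R X Y K' := by
  induction h generalizing K' with
  | base h => exact .base h
  | step h hb hY ih =>
    obtain ⟨K', rfl⟩ := Nat.exists_eq_add_of_le' (show 1 ≤ K' by omega)
    exact .step (ih (by omega)) hb hY

theorem mono_base (h : Gen R X Y K) (hX : X ⊆ X') : Gen R X' Y K := by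
  induction h with
  | base h => exact .base (h.trans hX)
  | step _ hb hY ih => exact .step ih hb hY

theorem union (hR : ∀ ⦃S T : Set α⦄ ⦃b : α⦄, S ⊆ T → R S b → R T b) (h : Gen R X Y K)
    (hW : W ⊆ X) : Gen R X (Y ∪ W) K := by
  induction h with
  | base h => exact .base (Set.union_subset h hW)
  | step _ hb hY ih =>
    refine .step ih (hR Set.subset_union_left hb) ?_
    rw [← Set.insert_union]
    exact Set.union_subset_union_left _ hY

theorem trans (h : Gen R X Y K) (h' : Gen R Y Z K') : Gen R X Z (K + K') := by
  induction h' with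
  | base h' => exact (h.mono h').mono_cost (by omega)
  | step _ hb hY ih => exact .step ih hb hY

theorem extend (hR : ∀ ⦃S T : Set α⦄ ⦃b : α⦄, S ⊆ T → R S b → R T b)
    (h : Gen R X Y K) (h' : Gen R (X ∪ Y) Z K') : Gen R X (X ∪ Y ∪ Z) (K + K') :=
  ((h.union hR subset_rfl).mono (by rw [Set.union_comm])).trans
    ((h'.union hR subset_rfl).mono (by rw [Set.union_comm]))

/-- Simulation of one rule by another one. -/
theorem image {β : Type*} {R' : Set β → β → Prop}
    (hR' : ∀ ⦃S T : Set β⦄ ⦃b : β⦄, S ⊆ T → R' S b → R' T b) (f : α → β) (c : ℕ)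
    (hf : ∀ (S : Set α) (b : α) (T : Set β), R S b → f '' S ⊆ T → Gen R' T {f b} c)
    (h : Gen R X Y K) : Gen R' (f '' X) (f '' Y) (c * K) := by
  induction h with
  | base h => exact .base (Set.image_mono h)
  | @step Y Z K b _ hb hY ih =>
    refine (ih.trans ((hf Y b _ hb subset_rfl).union hR' subset_rfl)).mono ?_ |>.mono_cost
      (by rw [Nat.mul_succ])
    refine (Set.image_mono hY).trans ?_
    rw [Set.image_insert_eq, Set.singleton_union]

/-- A finite set of elements, each of which follows from elements of smaller rank, costs at most
one application per element. -/
theorem of_rank (hR : ∀ ⦃S T : Set α⦄ ⦃b : α⦄, S ⊆ T → R S b → R T b) [DecidableEq α]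
    (W : Finset α) (μ : α → ℕ)
    (hW : ∀ b ∈ W, b ∈ X ∨ R (X ∪ {a | a ∈ W ∧ μ a < μ b}) b) :
    Gen R X (X ∪ W) W.card := by
  induction hn : W.card generalizing W with
  | zero =>
    rw [Finset.card_eq_zero] at hn
    subst hn
    exact .base (by simp)
  | succ n ih =>
    -- An element of maximal rank is not needed for any other one, so it can be derived last.
    obtain ⟨b, hb, hmax⟩ := W.exists_max_image μ (Finset.card_pos.1 (by omega))
    have key := ih (W.erase b) (fun a ha => by
      rcases hW a (Finset.mem_of_mem_erase ha) with h | h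
      · exact .inl h
      · refine .inr (hR ?_ h)
        refine Set.union_subset_union_right _ ?_
        rintro x ⟨hx, hlt⟩
        refine ⟨Finset.mem_erase.2 ⟨?_, hx⟩, hlt⟩
        rintro rfl
        exact absurd (hmax a (Finset.mem_of_mem_erase ha)) (by omega))
      (by rw [Finset.card_erase_of_mem hb]; omega)
    have hsub : X ∪ (W : Set α) ⊆ insert b (X ∪ (W.erase b : Set α)) := by
      rintro x (hx | hx)
      · exact .inr (.inl hx)
      · by_cases hxb : x = b
        · exact .inl hxb
        · exact .inr (.inr (Finset.mem_coe.2 (Finset.mem_erase.2 ⟨hxb, hx⟩)))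
    rcases hW b hb with h | h
    · exact (key.mono (hsub.trans (Set.insert_subset (.inl h) subset_rfl))).mono_cost (by omega)
    · refine .step key (hR ?_ h) hsub
      refine Set.union_subset_union_right _ ?_
      rintro x ⟨hx, hlt⟩
      exact Finset.mem_coe.2 (Finset.mem_erase.2 ⟨by rintro rfl; omega, hx⟩)

end Gen

/-! ### The Ackermann function against the iterated logarithms -/

theorem ackermann_lt_succ (i x : ℕ) : ackermann (i + 1) x < ackermann (i + 1) (x + 1) := by
  cases i with
  | zero =>
    have := lt_ackermann_succ 0 x
    simp only [ackermann] at this ⊢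
    omega
  | succ i =>
    rw [ackermann.eq_3]
    exact lt_ackermann_succ i _

theorem ackermann_mono (i : ℕ) : Monotone (ackermann i) := by
  cases i with
  | zero => intro x y h; simp only [ackermann]; omega
  | succ i => exact (strictMono_nat_of_lt_succ (ackermann_lt_succ i)).monotone

theorem ackermann_one (i : ℕ) : ackermann i 1 = 2 := by
  induction i with
  | zero => simp [ackermann]
  | succ i ih => simpa [ackermann] using ih

theorem ackermann_two (i : ℕ) : ackermann i 2 = 4 := by
  induction i with
  | zero => simp [ackermann]
  | succ i ih => rw [ackermann, ackermann_one, ih]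

theorem le_ackermann_four (i : ℕ) : i ≤ ackermann i 4 := by
  induction i with
  | zero => simp
  | succ i ih =>
    have h : ackermann (i + 1) 3 < ackermann (i + 1) 4 := ackermann_lt_succ i 3
    have h3 : ackermann (i + 1) 3 = ackermann i 4 := by rw [ackermann, ackermann_two]
    omega

/-- Two unfoldings give `A(i+1,4) = A(i,A(i,4))`, and `A(i,4) ≥ i`. This trades the diagonal
argument for the constant 4. -/
theorem ackermann_diag_le (i : ℕ) : ackermann i i ≤ ackermann (i + 1) 4 := by
  have h3 : ackermann (i + 1) 3 = ackermann i 4 := by rw [ackermann, ackermann_two]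
  rw [ackermann, h3]
  exact ackermann_mono i (le_ackermann_four i)

/-- This is the recursion `f (b n) + 1 ≤ f n` that `HasShortcuts.step` requires, for `b = logStar
i`. -/
theorem logStar_succ_of_two_le (i n : ℕ) (hn : 2 ≤ n) :
    logStar (i + 1) n = logStar (i + 1) (logStar i n) + 1 := by
  have h1 := iterate_logStar_lt_two i n
  have h2 := iterate_logStar_lt_two i (logStar i n)
  apply le_antisymm
  · refine Nat.sInf_le (s := {t | (logStar i)^[t] n < 2}) ?_
    exact h2
  · obtain ⟨t, ht⟩ : ∃ t, logStar (i + 1) n = t + 1 := by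
      refine Nat.exists_eq_succ_of_ne_zero fun h0 => ?_
      rw [h0] at h1
      exact absurd h1 (by simp only [Function.iterate_zero, id]; omega)
    rw [ht] at h1 ⊢
    exact Nat.succ_le_succ (Nat.sInf_le (s := {t | (logStar i)^[t] (logStar i n) < 2}) h1)

theorem logStar_of_lt_two (i n : ℕ) (hn : n < 2) : logStar i n = 0 := by
  cases i with
  | zero => exact Nat.log_of_lt hn
  | succ i => exact Nat.le_zero.1 (Nat.sInf_le (s := {t | (logStar i)^[t] n < 2}) hn)

theorem one_le_logStar (i n : ℕ) (hn : 2 ≤ n) : 1 ≤ logStar i n := by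
  cases i with
  | zero => exact Nat.log_pos (by norm_num) hn
  | succ i => rw [logStar_succ_of_two_le i n hn]; omega

theorem ackermann_one_left (x : ℕ) : ackermann 1 x = 2 ^ x := by
  induction x with
  | zero => simp [ackermann]
  | succ x ih => rw [ackermann, ih, ackermann, pow_succ, mul_comm]

/-- Row `i + 1` of the Ackermann function iterates row `i`, just as `logStar i` counts iterations of
`logStar (i - 1)`; so each bounds the inverse of the other, starting from `A(1,x) = 2^x`. -/
theorem logStar_le_of_le_ackermann (i n x : ℕ) (h : n ≤ ackermann (i + 1) x) :
    logStar i n ≤ x := by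
  induction i generalizing n x with
  | zero =>
    rw [ackermann_one_left] at h
    calc Nat.log 2 n ≤ Nat.log 2 (2 ^ x) := Nat.log_mono_right h
      _ = x := Nat.log_pow (by norm_num) x
  | succ i ihi =>
    induction x generalizing n with
    | zero =>
      rw [logStar_of_lt_two]
      rw [ackermann] at h
      omega
    | succ x ihx =>
      by_cases hn : 2 ≤ n
      · rw [logStar_succ_of_two_le i n hn]
        exact Nat.succ_le_succ (ihx _ (ihi _ _ (by rwa [ackermann] at h)))
      · rw [logStar_of_lt_two _ _ (by omega)]
        omega

theorem logStar_alpha_le (n : ℕ) : logStar (alpha n) n ≤ 4 :=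
  logStar_le_of_le_ackermann _ _ _ ((le_ackermann_alpha n).trans (ackermann_diag_le _))

theorem one_le_alpha (n : ℕ) (hn : 1 ≤ n) : 1 ≤ alpha n := by
  by_contra h
  have := le_ackermann_alpha n
  rw [show alpha n = 0 by omega, ackermann] at this
  omega

/-! ### Forests, paths and cuts -/

/-- A strict order in which the elements above any given element form a chain; `lt a b` is to be
read as: `b` is a proper ancestor of `a`. -/
structure IsForest {P : Type*} (lt : P → P → Prop) : Prop where
  irrefl : ∀ a, ¬lt a a
  trans : ∀ {a b c}, lt a b → lt b c → lt a c
  chain : ∀ {a b c}, lt a b → lt a c → lt b c ∨ b = c ∨ lt c b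

/-- The pairs in `V` that are immediate neighbours with respect to `lt`. -/
def coverPairs {P : Type*} (lt : P → P → Prop) (V : Finset P) : Set (P × P) :=
  {e | e.1 ∈ V ∧ e.2 ∈ V ∧ lt e.1 e.2 ∧ ∀ b ∈ V, ¬(lt e.1 b ∧ lt b e.2)}

/-- A pair is obtained from two pairs by transitivity. -/
def TransRule {P : Type*} (X : Set (P × P)) (e : P × P) : Prop :=
  ∃ b, (e.1, b) ∈ X ∧ (b, e.2) ∈ X

theorem TransRule.mono {P : Type*} ⦃X Y : Set (P × P)⦄ ⦃e : P × P⦄ (h : X ⊆ Y)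
    (he : TransRule X e) : TransRule Y e := by
  obtain ⟨b, h1, h2⟩ := he
  exact ⟨b, h h1, h h2⟩

/-- `c` is reached from `a` by at most `ℓ` pairs of `X`. -/
def HasPath {P : Type*} (X : Set (P × P)) : ℕ → P → P → Prop
  | 0, a, c => a = c
  | ℓ + 1, a, c => ∃ b, (a = b ∨ (a, b) ∈ X) ∧ HasPath X ℓ b c

namespace HasPath

variable {P : Type*} {X Y : Set (P × P)} {ℓ ℓ' : ℕ} {a b c : P}

theorem refl (X : Set (P × P)) (ℓ : ℕ) (a : P) : HasPath X ℓ a a := by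
  induction ℓ with
  | zero => rfl
  | succ ℓ ih => exact ⟨a, .inl rfl, ih⟩

theorem mono (h : HasPath X ℓ a c) (hX : X ⊆ Y) : HasPath Y ℓ a c := by
  induction ℓ generalizing a with
  | zero => exact h
  | succ ℓ ih =>
    obtain ⟨b, hb, h⟩ := h
    exact ⟨b, hb.imp_right fun h => hX h, ih h⟩

theorem snoc (h : HasPath X ℓ a b) (hb : b = c ∨ (b, c) ∈ X) : HasPath X (ℓ + 1) a c := by
  induction ℓ generalizing a with
  | zero =>
    cases h
    exact ⟨c, hb, rfl⟩
  | succ ℓ ih =>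
    obtain ⟨d, hd, h⟩ := h
    exact ⟨d, hd, ih h⟩

theorem of_eq_or_mem (h : a = c ∨ (a, c) ∈ X) : HasPath X (ℓ + 1) a c :=
  ⟨c, h, refl X ℓ c⟩

end HasPath

/-- The order that is left of `lt` when the members of `S` are cut out. -/
def cutOrder {P : Type*} (lt : P → P → Prop) (S : Finset P) (w u : P) : Prop :=
  lt w u ∧ w ∉ S ∧ u ∉ S ∧ ∀ s ∈ S, ¬(lt w s ∧ lt s u)

/-- With base pairs the neighbours in `V`, at most `C * (V.card * g n)` transitivity steps produce
a set of pairs by which all ancestors are reached in at most `ℓ` steps; `n` bounds the number of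
descendants. -/
def HasShortcuts (P : Type*) (C ℓ : ℕ) (g : ℕ → ℕ) : Prop :=
  ∀ (lt : P → P → Prop), IsForest lt → ∀ (V : Finset P) (n : ℕ),
    (∀ u ∈ V, {w | w ∈ V ∧ lt w u}.ncard < n) →
    ∃ X, Gen TransRule (coverPairs lt V) X (C * (V.card * g n)) ∧
      ∀ a ∈ V, ∀ c ∈ V, lt a c → HasPath X ℓ a c

section Forest

variable {P : Type*} {lt : P → P → Prop}

theorem IsForest.cut (h : IsForest lt) (S : Finset P) : IsForest (cutOrder lt S) where
  irrefl a ha := h.irrefl a ha.1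
  trans := by
    rintro a b c ⟨h1, h2, h3, h4⟩ ⟨h5, _, h6, h7⟩
    refine ⟨h.trans h1 h5, h2, h6, fun s hs ⟨h8, h9⟩ => ?_⟩
    rcases h.chain h8 h1 with h10 | h10 | h10
    · exact h4 s hs ⟨h8, h10⟩
    · exact h3 (h10 ▸ hs)
    · exact h7 s hs ⟨h10, h9⟩
  chain := by
    rintro a b c ⟨h1, h2, h3, h4⟩ ⟨h5, _, h6, h7⟩
    rcases h.chain h1 h5 with h8 | h8 | h8
    · exact .inl ⟨h8, h3, h6, fun s hs h9 => h7 s hs ⟨h.trans h1 h9.1, h9.2⟩⟩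
    · exact .inr (.inl h8)
    · exact .inr (.inr ⟨h8, h6, h3, fun s hs h9 => h4 s hs ⟨h.trans h5 h9.1, h9.2⟩⟩)

theorem finite_sep (V : Finset P) (p : P → Prop) : {w | w ∈ V ∧ p w}.Finite :=
  V.finite_toSet.subset fun _ h => h.1

theorem ncard_sep_le (V : Finset P) {p q : P → Prop} (h : ∀ w ∈ V, p w → q w) :
    {w | w ∈ V ∧ p w}.ncard ≤ {w | w ∈ V ∧ q w}.ncard :=
  Set.ncard_le_ncard (fun w hw => ⟨hw.1, h w hw.1 hw.2⟩) (finite_sep V q)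

theorem ncard_sep_lt (V : Finset P) {p q : P → Prop} (h : ∀ w ∈ V, p w → q w) (x : P)
    (hx : x ∈ V) (hq : q x) (hp : ¬p x) :
    {w | w ∈ V ∧ p w}.ncard < {w | w ∈ V ∧ q w}.ncard := by
  have hsub : {w | w ∈ V ∧ p w} ⊆ {w | w ∈ V ∧ q w} := fun w hw => ⟨hw.1, h w hw.1 hw.2⟩
  exact Set.ncard_lt_ncard ((Set.ssubset_iff_of_subset hsub).2
    ⟨x, ⟨hx, hq⟩, fun h => hp h.2⟩) (finite_sep V q)

theorem IsForest.exists_minimal (h : IsForest lt) (V : Finset P) (p : P → Prop) {x : P}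
    (hx : x ∈ V) (hp : p x) : ∃ y ∈ V, p y ∧ ∀ z ∈ V, p z → ¬lt z y := by
  induction hn : {w | w ∈ V ∧ lt w x}.ncard using Nat.strong_induction_on generalizing x with
  | _ n ih =>
    by_cases hz : ∃ z ∈ V, p z ∧ lt z x
    · obtain ⟨z, hzV, hpz, hzx⟩ := hz
      exact ih _ (hn ▸ ncard_sep_lt V (fun w _ hw => h.trans hw hzx) z hzV hzx (h.irrefl z))
        hzV hpz rfl
    · exact ⟨x, hx, hp, fun z hzV hpz hzx => hz ⟨z, hzV, hpz, hzx⟩⟩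

theorem IsForest.swap_exists_maximal (h : IsForest lt) (V : Finset P) (p : P → Prop) {x : P}
    (hx : x ∈ V) (hp : p x) : ∃ y ∈ V, p y ∧ ∀ z ∈ V, p z → ¬lt y z := by
  induction hn : {w | w ∈ V ∧ lt x w}.ncard using Nat.strong_induction_on generalizing x with
  | _ n ih =>
    by_cases hz : ∃ z ∈ V, p z ∧ lt x z
    · obtain ⟨z, hzV, hpz, hzx⟩ := hz
      exact ih _ (hn ▸ ncard_sep_lt V (fun w _ hw => h.trans hzx hw) z hzV hzx (h.irrefl z))
        hzV hpz rfl
    · exact ⟨x, hx, hp, fun z hzV hpz hzx => hz ⟨z, hzV, hpz, hzx⟩⟩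

/-- Few elements cut a finite forest into pieces with few descendants. -/
theorem IsForest.exists_cut (h : IsForest lt) (b : ℕ) (V : Finset P) :
    ∃ S ⊆ V, b * S.card ≤ V.card ∧
      ∀ u ∈ V, u ∉ S → {w | w ∈ V ∧ cutOrder lt S w u}.ncard < b := by
  classical
  induction V using Finset.strongInduction with
  | H V ih =>
    by_cases hv : ∃ v ∈ V, b ≤ {w | w ∈ V ∧ lt w v}.ncard
    · obtain ⟨v₀, hv₀, hb₀⟩ := hv
      -- A lowest `v` with at least `b` descendants is put into `S`. Removing `v` and its
      -- descendants takes away more than `b` elements, which pays for `v`, and below `v` nothing is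
      -- left to cut.
      obtain ⟨v, hvV, hbv, hmin⟩ := h.exists_minimal V
        (fun v => b ≤ {w | w ∈ V ∧ lt w v}.ncard) hv₀ hb₀
      obtain ⟨S, hSV, hScard, hS⟩ := ih (V.filter fun w => ¬(w = v ∨ lt w v))
        (Finset.filter_ssubset.2 ⟨v, hvV, by simp⟩)
      have hvS : v ∉ S := fun hs => (Finset.mem_filter.1 (hSV hs)).2 (.inl rfl)
      refine ⟨insert v S, Finset.insert_subset hvV (hSV.trans (Finset.filter_subset _ _)), ?_, ?_⟩
      · rw [Finset.card_insert_of_notMem hvS]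
        have h1 := Finset.card_filter_add_card_filter_not (s := V) (fun w => w = v ∨ lt w v)
        have h2 : {w | w ∈ V ∧ lt w v}.ncard ≤ (V.filter fun w => w = v ∨ lt w v).card := by
          rw [← Set.ncard_coe_finset]
          exact Set.ncard_le_ncard (fun w hw => by simp [hw.1, hw.2]) (Finset.finite_toSet _)
        rw [Nat.mul_succ]
        omega
      · intro u hu huS
        have huv : u ≠ v := fun h => huS (h ▸ Finset.mem_insert_self _ _)
        have huS' : u ∉ S := fun h => huS (Finset.mem_insert_of_mem h)
        by_cases hlt : lt u v
        · refine lt_of_le_of_lt (ncard_sep_le V (q := fun w => lt w u) fun w _ hw => hw.1) ?_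
          by_contra hcon
          exact hmin u hu (not_lt.1 hcon) hlt
        · refine lt_of_le_of_lt (Set.ncard_le_ncard ?_ (finite_sep _ _))
            (hS u (Finset.mem_filter.2 ⟨hu, by tauto⟩) huS')
          rintro w ⟨hw, h1, h2, h3, h4⟩
          refine ⟨Finset.mem_filter.2 ⟨hw, ?_⟩, h1, fun h => h2 (Finset.mem_insert_of_mem h),
            huS', fun s hs => h4 s (Finset.mem_insert_of_mem hs)⟩
          -- If `w` lies below `v` while `u` does not, then `v` separates `w` from `u`, so `w` is
          -- not below `u` in the cut order.
          rintro (rfl | hwv)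
          · exact h2 (Finset.mem_insert_self _ _)
          · rcases h.chain hwv h1 with h5 | h5 | h5
            · exact h4 v (Finset.mem_insert_self _ _) ⟨hwv, h5⟩
            · exact huv h5.symm
            · exact hlt h5
    · refine ⟨∅, by simp, by simp, fun u hu _ => ?_⟩
      refine lt_of_le_of_lt (ncard_sep_le V (q := fun w => lt w u) fun w _ hw => hw.1) ?_
      by_contra hcon
      exact hv ⟨u, hu, not_lt.1 hcon⟩

theorem IsForest.exists_cover_left (h : IsForest lt) (V : Finset P) {a c : P} (ha : a ∈ V)
    (hc : c ∈ V) (hac : lt a c) (hn : (a, c) ∉ coverPairs lt V) :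
    ∃ b ∈ V, lt b c ∧ (a, b) ∈ coverPairs lt V := by
  have hb : ∃ b ∈ V, lt a b ∧ lt b c := by
    by_contra hcon
    exact hn ⟨ha, hc, hac, fun b hb hb' => hcon ⟨b, hb, hb'⟩⟩
  obtain ⟨b₀, hb₀, hb₀'⟩ := hb
  obtain ⟨b, hbV, hb, hmin⟩ := h.exists_minimal V (fun b => lt a b ∧ lt b c) hb₀ hb₀'
  exact ⟨b, hbV, hb.2, ha, hbV, hb.1, fun d hd hd' =>
    hmin d hd ⟨hd'.1, h.trans hd'.2 hb.2⟩ hd'.2⟩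

theorem IsForest.exists_cover_right (h : IsForest lt) (V : Finset P) {a c : P} (ha : a ∈ V)
    (hc : c ∈ V) (hac : lt a c) (hn : (a, c) ∉ coverPairs lt V) :
    ∃ b ∈ V, lt a b ∧ (b, c) ∈ coverPairs lt V := by
  have hb : ∃ b ∈ V, lt a b ∧ lt b c := by
    by_contra hcon
    exact hn ⟨ha, hc, hac, fun b hb hb' => hcon ⟨b, hb, hb'⟩⟩
  obtain ⟨b₀, hb₀, hb₀'⟩ := hb
  obtain ⟨b, hbV, hb, hmin⟩ := h.swap_exists_maximal V (fun b => lt a b ∧ lt b c) hb₀ hb₀'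
  exact ⟨b, hbV, hb.1, hbV, hc, hb.2, fun d hd hd' =>
    hmin d hd ⟨h.trans hb.1 hd'.1, hd'.2⟩ hd'.1⟩

/-- One transitivity step per pair suffices: each pair splits into a neighbour pair and a pair of
`W` with fewer elements strictly between its ends, and that number serves as the rank. -/
theorem IsForest.gen_all (h : IsForest lt) [DecidableEq P] (V : Finset P) (W : Finset (P × P))
    (hW : ∀ e ∈ W, e ∈ coverPairs lt V ∨
      (∃ b ∈ V, lt b e.2 ∧ (e.1, b) ∈ coverPairs lt V ∧ (b, e.2) ∈ W) ∨
      ∃ b ∈ V, lt e.1 b ∧ (b, e.2) ∈ coverPairs lt V ∧ (e.1, b) ∈ W) :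
    Gen TransRule (coverPairs lt V) (coverPairs lt V ∪ W) W.card := by
  refine Gen.of_rank TransRule.mono W (fun e => {w | w ∈ V ∧ lt e.1 w ∧ lt w e.2}.ncard) ?_
  rintro ⟨a, c⟩ he
  rcases hW _ he with h1 | ⟨b, hb, hbc, hab, hW1⟩ | ⟨b, hb, hab, hbc, hW1⟩
  · exact .inl h1
  · refine .inr ⟨b, .inl hab, .inr ⟨hW1, ?_⟩⟩
    exact ncard_sep_lt V (fun w _ hw => ⟨h.trans hab.2.2.1 hw.1, hw.2⟩) b hb
      ⟨hab.2.2.1, hbc⟩ fun h' => h.irrefl b h'.1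
  · refine .inr ⟨b, .inr ⟨hW1, ?_⟩, .inl hbc⟩
    exact ncard_sep_lt V (fun w _ hw => ⟨hw.1, h.trans hw.2 hbc.2.2.1⟩) b hb
      ⟨hab, hbc.2.2.1⟩ fun h' => h.irrefl b h'.2

end Forest

/-! ### The hierarchy of shortcut sets -/

/-- The start of the hierarchy takes all pairs: each upper end has fewer than `n` descendants. -/
theorem hasShortcuts_id (P : Type*) : HasShortcuts P 1 1 id := by
  classical
  intro lt h V n hn
  set W : Finset (P × P) := (V ×ˢ V).filter fun e => lt e.1 e.2 with hWdef
  have hW : ∀ e, e ∈ W ↔ e.1 ∈ V ∧ e.2 ∈ V ∧ lt e.1 e.2 := fun e => by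
    simp [hWdef, and_assoc]
  have hcard : W.card ≤ n * V.card := by
    refine Finset.card_le_mul_card_image_of_maps_to (f := Prod.snd)
      (fun e he => ((hW e).1 he).2.1) n fun c hc => ?_
    refine le_trans ?_ (hn c hc).le
    rw [← Set.ncard_coe_finset]
    refine Set.ncard_le_ncard_of_injOn Prod.fst ?_ ?_ (finite_sep _ _)
    · intro e he
      obtain ⟨he', rfl⟩ := Finset.mem_filter.1 (Finset.mem_coe.1 he)
      exact ⟨((hW e).1 he').1, ((hW e).1 he').2.2⟩
    · intro e he e' he' heq
      have h1 := (Finset.mem_filter.1 (Finset.mem_coe.1 he)).2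
      have h2 := (Finset.mem_filter.1 (Finset.mem_coe.1 he')).2
      exact Prod.ext heq (h1.trans h2.symm)
  refine ⟨_, (h.gen_all V W fun e he => ?_).mono_cost ?_, ?_⟩
  · obtain ⟨h1, h2, h3⟩ := (hW e).1 he
    by_cases hc : e ∈ coverPairs lt V
    · exact .inl hc
    · obtain ⟨b, hb, hbc, hab⟩ := h.exists_cover_left V h1 h2 h3 hc
      exact .inr (.inl ⟨b, hb, hbc, hab, (hW _).2 ⟨hb, h2, hbc⟩⟩)
  · rw [one_mul, id, mul_comm]
    exact hcard
  · intro a ha c hc hac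
    exact HasPath.of_eq_or_mem (.inr (.inr (Finset.mem_coe.2 ((hW _).2 ⟨ha, hc, hac⟩))))

/-- The links from members of `V` outside the cut set `S` up to the next member of `S`, and from
members of `S` up through the piece above, as far as the next member of `S`. -/
def IsCutLink {P : Type*} (lt : P → P → Prop) (S : Finset P) (e : P × P) : Prop :=
  lt e.1 e.2 ∧ (e.1 ∈ S ∨ e.2 ∈ S) ∧ ∀ s ∈ S, ¬(lt e.1 s ∧ lt s e.2)

/-- The members of `S` above a given element form a chain, so the nearest of them is unique and the
lower end determines the link. -/
theorem IsForest.card_links_up {P : Type*} [DecidableEq P] {lt : P → P → Prop} (h : IsForest lt)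
    (V S : Finset P) (W : Finset (P × P))
    (hW : ∀ e ∈ W, e.1 ∈ V ∧ e.2 ∈ S ∧ lt e.1 e.2 ∧ ∀ s ∈ S, ¬(lt e.1 s ∧ lt s e.2)) :
    W.card ≤ V.card := by
  refine Finset.card_le_card_of_injOn Prod.fst (fun e he => (hW e he).1) ?_
  rintro ⟨a, s⟩ he ⟨a', s'⟩ he' heq
  obtain rfl : a = a' := heq
  obtain ⟨-, h1, h2, h3⟩ := hW _ he
  obtain ⟨-, h1', h2', h3'⟩ := hW _ he'
  rcases h.chain h2 h2' with h4 | h4 | h4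
  · exact absurd ⟨h2, h4⟩ (h3' s h1)
  · exact Prod.ext rfl h4
  · exact absurd ⟨h2', h4⟩ (h3 s' h1')

/-- The upper ends of the links from a fixed `s` form a chain within one piece. All but the topmost
are descendants of the topmost in the cut order, fewer than `b` in number, so there are at most `b`
links from `s`. -/
theorem IsForest.card_links_out {P : Type*} [DecidableEq P] {lt : P → P → Prop} (h : IsForest lt)
    (V S : Finset P) (b : ℕ) (hS : ∀ u ∈ V, u ∉ S → {w | w ∈ V ∧ cutOrder lt S w u}.ncard < b)
    (W : Finset (P × P))
    (hW : ∀ e ∈ W, e.1 ∈ S ∧ e.2 ∈ V ∧ e.2 ∉ S ∧ lt e.1 e.2 ∧ ∀ s ∈ S, ¬(lt e.1 s ∧ lt s e.2)) :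
    W.card ≤ b * S.card := by
  refine Finset.card_le_mul_card_image_of_maps_to (f := Prod.fst) (fun e he => (hW e he).1) b
    fun s hs => ?_
  set F : Finset P := (W.filter fun e => e.1 = s).image Prod.snd with hF
  have hmem : ∀ c, c ∈ F ↔ (s, c) ∈ W := fun c => by simp [hF]
  have hcard : (W.filter fun e => e.1 = s).card = F.card := by
    refine (Finset.card_image_of_injOn ?_).symm
    intro e he e' he' heq
    have h1 := (Finset.mem_filter.1 (Finset.mem_coe.1 he)).2
    have h2 := (Finset.mem_filter.1 (Finset.mem_coe.1 he')).2
    exact Prod.ext (h1.trans h2.symm) heq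
  rw [hcard]
  rcases F.eq_empty_or_nonempty with hemp | ⟨c₀, hc₀⟩
  · simp [hemp]
  obtain ⟨t, ht, -, hmax⟩ := h.swap_exists_maximal F (fun _ => True) hc₀ trivial
  obtain ⟨-, h1, h2, h3, h4⟩ := hW _ ((hmem t).1 ht)
  have hsub : (F.erase t).card ≤ {w | w ∈ V ∧ LukNested.cutOrder lt S w t}.ncard := by
    rw [← Set.ncard_coe_finset]
    refine Set.ncard_le_ncard (fun w hw => ?_) (finite_sep _ _)
    obtain ⟨hwt, hwF⟩ := Finset.mem_erase.1 (Finset.mem_coe.1 hw)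
    obtain ⟨-, h1', h2', h3', h4'⟩ := hW _ ((hmem w).1 hwF)
    have hlt : lt w t := by
      rcases h.chain h3 h3' with h5 | h5 | h5
      · exact absurd h5 (hmax w hwF trivial)
      · exact absurd h5.symm hwt
      · exact h5
    exact ⟨h1', hlt, h2', h2, fun s' hs' h5 => h4 s' hs' ⟨h.trans h3' h5.1, h5.2⟩⟩
  have := hS t h1 h2
  rw [Finset.card_erase_of_mem ht] at hsub
  omega

/-- With a cut at `b n`, we have `b n * |S| ≤ |V|`. Hence the given shortcuts on `S` cost at most `C
* K * |V|`, as `g n ≤ K * b n`, and the links at most `2 * |V|`. All pieces are treated by one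
recursive call for the cut order, with descendant bound `b n`; the spare 1 in `f (b n) + 1 ≤ f n`
pays for the current round. A path gains one link at either end, but only in the round where it is
first cut, so the length does not grow with the depth of the recursion. -/
theorem HasShortcuts.step {P : Type*} {C ℓ K : ℕ} {g b f : ℕ → ℕ} (H : HasShortcuts P C ℓ g)
    (hb : ∀ n, 2 ≤ n → g n ≤ K * b n ∧ b n < n ∧ f (b n) + 1 ≤ f n) :
    HasShortcuts P (C * K + 3) (ℓ + 2) f := by
  classical
  intro lt h V n hn
  induction n using Nat.strong_induction_on generalizing lt V with
  | _ n ih =>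
  by_cases hn2 : n < 2
  -- For `n < 2` no element has a descendant, so there is nothing to connect.
  · refine ⟨∅, .base (Set.empty_subset _), fun a ha c hc hac => ?_⟩
    have h1 := hn c hc
    have h2 : 0 < {w | w ∈ V ∧ lt w c}.ncard :=
      (Set.ncard_pos (finite_sep _ _)).2 ⟨a, ha, hac⟩
    omega
  obtain ⟨hgb, hbn, hf⟩ := hb n (not_lt.1 hn2)
  obtain ⟨S, hSV, hScard, hS⟩ := h.exists_cut (b n) V
  have hncard : ∀ {p : P → Prop} {u : P}, (∀ w ∈ S, p w → lt w u) →
      {w | w ∈ S ∧ p w}.ncard ≤ {w | w ∈ V ∧ lt w u}.ncard := fun hp =>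
    Set.ncard_le_ncard (fun w hw => ⟨hSV hw.1, hp w hw.1 hw.2⟩) (finite_sep _ _)
  obtain ⟨X₁, hX₁, hp₁⟩ := H lt h S n fun u hu =>
    lt_of_le_of_lt (hncard fun _ _ hw => hw) (hn u (hSV hu))
  obtain ⟨X₂, hX₂, hp₂⟩ := ih (b n) hbn (cutOrder lt S) (h.cut S) (V \ S) (by
    intro u hu
    rw [Finset.mem_sdiff] at hu
    refine lt_of_le_of_lt (Set.ncard_le_ncard ?_ (finite_sep _ _)) (hS u hu.1 hu.2)
    exact fun w hw => ⟨(Finset.mem_sdiff.1 hw.1).1, hw.2⟩)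
  set W : Finset (P × P) := (V ×ˢ V).filter (IsCutLink lt S) with hWdef
  have hW : ∀ e, e ∈ W ↔ e.1 ∈ V ∧ e.2 ∈ V ∧ IsCutLink lt S e := fun e => by
    simp [hWdef, and_assoc]
  have hWcard : W.card ≤ 2 * V.card := by
    rw [← Finset.card_filter_add_card_filter_not (fun e => e.2 ∈ S)]
    have h1 := h.card_links_up V S (W.filter fun e => e.2 ∈ S) fun e he => by
      rw [Finset.mem_filter, hW] at he
      exact ⟨he.1.1, he.2, he.1.2.2.1, he.1.2.2.2.2⟩
    have h2 := h.card_links_out V S (b n) hS (W.filter fun e => ¬e.2 ∈ S) fun e he => by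
      rw [Finset.mem_filter, hW] at he
      exact ⟨he.1.2.2.2.1.resolve_right he.2, he.1.2.1, he.2, he.1.2.2.1, he.1.2.2.2.2⟩
    omega
  have hgenW : Gen TransRule (coverPairs lt V) (coverPairs lt V ∪ W) W.card := by
    refine h.gen_all V W fun e he => ?_
    obtain ⟨h1, h2, h3, h4, h5⟩ := (hW e).1 he
    by_cases hc : e ∈ coverPairs lt V
    · exact .inl hc
    · refine .inr ?_
      rcases h4 with h4 | h4
      · obtain ⟨d, hd, hed, hd'⟩ := h.exists_cover_right V h1 h2 h3 hc
        exact .inr ⟨d, hd, hed, hd', (hW _).2 ⟨h1, hd, hed, .inl h4, fun s hs hs' =>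
          h5 s hs ⟨hs'.1, h.trans hs'.2 hd'.2.2.1⟩⟩⟩
      · obtain ⟨d, hd, hed, hd'⟩ := h.exists_cover_left V h1 h2 h3 hc
        exact .inl ⟨d, hd, hed, hd', (hW _).2 ⟨hd, h2, hed, .inr h4, fun s hs hs' =>
          h5 s hs ⟨h.trans hd'.2.2.1 hs'.1, hs'.2⟩⟩⟩
  have hcovS : coverPairs lt S ⊆ coverPairs lt V ∪ W := fun e he => by
    obtain ⟨h1, h2, h3, h4⟩ := he
    exact .inr (Finset.mem_coe.2 ((hW e).2 ⟨hSV h1, hSV h2, h3, .inl h1, h4⟩))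
  -- Pieces are convex: anything between two elements of a piece lies in that piece.
  have hcovR : coverPairs (cutOrder lt S) (V \ S) ⊆ coverPairs lt V := fun e he => by
    obtain ⟨h1, h2, ⟨h3, h4, h5, h6⟩, h7⟩ := he
    refine ⟨(Finset.mem_sdiff.1 h1).1, (Finset.mem_sdiff.1 h2).1, h3, fun d hd hd' => ?_⟩
    have hdS : d ∉ S := fun hs => h6 d hs hd'
    exact h7 d (Finset.mem_sdiff.2 ⟨hd, hdS⟩)
      ⟨⟨hd'.1, h4, hdS, fun s hs hs' => h6 s hs ⟨hs'.1, h.trans hs'.2 hd'.2⟩⟩,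
        ⟨hd'.2, hdS, h5, fun s hs hs' => h6 s hs ⟨h.trans hd'.1 hs'.1, hs'.2⟩⟩⟩
  refine ⟨coverPairs lt V ∪ (W ∪ X₁) ∪ X₂, ?_, ?_⟩
  · have g1 := hgenW.extend TransRule.mono (hX₁.mono_base (hcovS.trans Set.subset_union_right))
    have g2 := (g1.mono (Z := W ∪ X₁) (by
      intro e he
      rcases he with he | he
      · exact .inl (.inr (.inr he))
      · exact .inr he)).extend TransRule.mono
        ((hX₂.mono_base hcovR).mono_base Set.subset_union_left)
    refine g2.mono_cost ?_
    have c1 : C * (S.card * g n) ≤ C * K * V.card := by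
      calc C * (S.card * g n) ≤ C * (S.card * (K * b n)) := by gcongr
        _ = C * K * (b n * S.card) := by ring
        _ ≤ C * K * V.card := by gcongr
    have c2 : (C * K + 3) * ((V \ S).card * f (b n)) ≤ (C * K + 3) * (V.card * f (b n)) := by
      gcongr
      exact Finset.sdiff_subset
    calc W.card + C * (S.card * g n) + (C * K + 3) * ((V \ S).card * f (b n))
        ≤ 3 * V.card + C * K * V.card + (C * K + 3) * (V.card * f (b n)) := by omega
      _ = (C * K + 3) * (V.card * (f (b n) + 1)) := by ring
      _ ≤ (C * K + 3) * (V.card * f n) := by gcongr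
  · intro a ha c hc hac
    -- If `S` meets the interval from `a` to `c`, its lowest and highest members `s`, `t` there give
    -- the path `a → s → ⋯ → t → c`. Otherwise `a` and `c` lie in one piece and the recursion
    -- applies.
    by_cases hcut : ∃ s ∈ S, (s = a ∨ lt a s) ∧ (s = c ∨ lt s c)
    · obtain ⟨s₀, hs₀, hs₀'⟩ := hcut
      obtain ⟨s, hs, hs', hsmin⟩ := h.exists_minimal S
        (fun s => (s = a ∨ lt a s) ∧ (s = c ∨ lt s c)) hs₀ hs₀'
      obtain ⟨t, ht, ht', htmax⟩ := h.swap_exists_maximal S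
        (fun s => (s = a ∨ lt a s) ∧ (s = c ∨ lt s c)) hs₀ hs₀'
      have e1 : a = s ∨ (a, s) ∈ coverPairs lt V ∪ (W ∪ X₁) ∪ X₂ := by
        rcases hs'.1 with rfl | has
        · exact .inl rfl
        · refine .inr (.inl (.inr (.inl (Finset.mem_coe.2 ((hW _).2
            ⟨ha, hSV hs, has, .inr hs, fun d hd hd' => ?_⟩)))))
          refine hsmin d hd ⟨.inr hd'.1, .inr ?_⟩ hd'.2
          rcases hs'.2 with rfl | hsc
          · exact hd'.2
          · exact h.trans hd'.2 hsc
      have e2 : t = c ∨ (t, c) ∈ coverPairs lt V ∪ (W ∪ X₁) ∪ X₂ := by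
        rcases ht'.2 with rfl | htc
        · exact .inl rfl
        · refine .inr (.inl (.inr (.inl (Finset.mem_coe.2 ((hW _).2
            ⟨hSV ht, hc, htc, .inl ht, fun d hd hd' => ?_⟩)))))
          refine htmax d hd ⟨.inr ?_, .inr hd'.2⟩ hd'.1
          rcases ht'.1 with rfl | hat
          · exact hd'.1
          · exact h.trans hat hd'.1
      have e3 : HasPath (coverPairs lt V ∪ (W ∪ X₁) ∪ X₂) ℓ s t := by
        have hst : s = t ∨ lt s t := by
          rcases hs'.1 with rfl | has
          · exact ht'.1.imp_left Eq.symm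
          · rcases ht'.1 with rfl | hat
            · exact absurd has (hsmin t ht ht')
            · rcases h.chain has hat with h5 | h5 | h5
              · exact .inr h5
              · exact .inl h5
              · exact absurd h5 (hsmin t ht ht')
        rcases hst with rfl | hst
        · exact HasPath.refl _ _ _
        · exact (hp₁ s hs t ht hst).mono fun e he => .inl (.inr (.inr he))
      exact HasPath.snoc ⟨s, e1, e3⟩ e2
    · have hnot : ∀ s ∈ S, ¬((s = a ∨ lt a s) ∧ (s = c ∨ lt s c)) := fun s hs hs' =>
        hcut ⟨s, hs, hs'⟩
      have haS : a ∉ S := fun hs => hnot a hs ⟨.inl rfl, .inr hac⟩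
      have hcS : c ∉ S := fun hs => hnot c hs ⟨.inr hac, .inl rfl⟩
      exact (hp₂ a (Finset.mem_sdiff.2 ⟨ha, haS⟩) c (Finset.mem_sdiff.2 ⟨hc, hcS⟩)
        ⟨hac, haS, hcS, fun s hs hs' => hnot s hs ⟨.inr hs'.1, .inr hs'.2⟩⟩).mono fun e he => .inr he

theorem hasShortcuts_logStar (P : Type*) (i : ℕ) :
    HasShortcuts P (6 + 3 * i) (3 + 2 * i) (logStar i) := by
  induction i with
  | zero =>
    refine (hasShortcuts_id P).step (K := 3) (b := fun n => n / 2) fun n hn => ?_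
    -- The choice `K = 3` comes from `n ≤ 3 * (n / 2)` for `n ≥ 2`, which is sharp at `n = 3`.
    refine ⟨by simp only [id]; omega, Nat.div_lt_self (by omega) (by norm_num), ?_⟩
    simp only [logStar]
    rw [Nat.log_of_one_lt_of_le (by norm_num) hn]
  | succ i ih =>
    have := ih.step (K := 1) (b := logStar i) (f := logStar (i + 1)) fun n hn =>
      ⟨by omega, logStar_lt i n hn, (logStar_succ_of_two_le i n hn).ge⟩
    convert this using 1 <;> ring

/-! ### Frege derivations and their substitution instances -/

theorem Formula.subst_subst (σ τ : ℕ → Formula) (A : Formula) :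
    (A.subst τ).subst σ = A.subst fun p => (τ p).subst σ := by
  induction A <;> simp_all [Formula.subst]

/-- One step of a proof in the Frege system. -/
def FregeRule (Sch : Finset Formula) (X : Set Formula) (B : Formula) : Prop :=
  IsAxiom Sch B ∨ ∃ A ∈ X, Formula.imp A B ∈ X

theorem FregeRule.mono {Sch : Finset Formula} ⦃X Y : Set Formula⦄ ⦃B : Formula⦄ (h : X ⊆ Y)
    (hB : FregeRule Sch X B) : FregeRule Sch Y B := by
  rcases hB with hB | ⟨A, hA, hAB⟩
  · exact .inl hB
  · exact .inr ⟨A, h hA, h hAB⟩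

theorem IsAxiom.subst {Sch : Finset Formula} {B : Formula} (h : IsAxiom Sch B)
    (σ : ℕ → Formula) : IsAxiom Sch (B.subst σ) := by
  obtain ⟨S, hS, τ, rfl⟩ := h
  exact ⟨S, hS, _, Formula.subst_subst σ τ S⟩

theorem IsDerivation.left {Sch : Finset Formula} {Γ : Set Formula} {L L' : List Formula}
    (h : IsDerivation Sch Γ (L ++ L')) : IsDerivation Sch Γ L := by
  rintro L₁ B L₂ rfl
  exact h L₁ B (L₂ ++ L') (by simp)

theorem IsDerivation.snoc {Sch : Finset Formula} {Γ : Set Formula} {L : List Formula}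
    {B : Formula} (h : IsDerivation Sch Γ L)
    (hB : IsAxiom Sch B ∨ B ∈ Γ ∨ ∃ A ∈ L, Formula.imp A B ∈ L) :
    IsDerivation Sch Γ (L ++ [B]) := by
  intro L₁ D L₂ heq
  rcases List.eq_nil_or_concat L₂ with rfl | ⟨L₃, E, rfl⟩
  · obtain ⟨rfl, h2⟩ := List.append_inj' heq rfl
    obtain rfl : B = D := by simpa using h2
    exact hB
  · refine h L₁ D L₃ ?_
    rw [List.concat_eq_append, ← List.cons_append, ← List.append_assoc] at heq
    exact (List.append_inj' heq rfl).1

theorem IsDerivation.gen_subst {Sch : Finset Formula} {Γ : Set Formula} {L : List Formula}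
    (h : IsDerivation Sch Γ L) (σ : ℕ → Formula) {X : Set Formula}
    (hX : ∀ A ∈ Γ, A.subst σ ∈ X) :
    Gen (FregeRule Sch) X (X ∪ {B | ∃ A ∈ L, B = A.subst σ}) L.length := by
  induction L using List.reverseRecOn with
  | nil => exact .base (by simp)
  | append_singleton L B ih =>
    have ih := ih h.left
    have hsub : X ∪ {D | ∃ A ∈ L ++ [B], D = A.subst σ} ⊆
        insert (B.subst σ) (X ∪ {D | ∃ A ∈ L, D = A.subst σ}) := by
      rintro D (hD | ⟨A, hA, rfl⟩)
      · exact .inr (.inl hD)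
      · rcases List.mem_append.1 hA with hA | hA
        · exact .inr (.inr ⟨A, hA, rfl⟩)
        · rw [List.mem_singleton] at hA
          exact .inl (by rw [hA])
    rw [List.length_append, List.length_singleton]
    rcases h L B [] rfl with hB | hB | ⟨A, hA, hAB⟩
    · exact .step ih (.inl (hB.subst σ)) hsub
    · exact (ih.mono (hsub.trans (Set.insert_subset (.inl (hX B hB)) subset_rfl))).mono_cost
        (Nat.le_succ _)
    · exact .step ih (.inr ⟨A.subst σ, .inr ⟨A, hA, rfl⟩, .inr ⟨_, hAB, rfl⟩⟩) hsub

theorem Gen.exists_isDerivation {Sch : Finset Formula} {Y : Set Formula} {K : ℕ}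
    (h : Gen (FregeRule Sch) ∅ Y K) :
    ∃ L, IsDerivation Sch ∅ L ∧ L.length ≤ K ∧ ∀ B ∈ Y, B ∈ L := by
  induction h with
  | base h => exact ⟨[], fun L₁ B L₂ h => by simp at h, by simp, fun B hB => (h hB).elim⟩
  | @step Y Z K B _ hB hZ ih =>
    obtain ⟨L, hL, hlen, hmem⟩ := ih
    refine ⟨L ++ [B], hL.snoc ?_, by simpa using hlen, fun D hD => ?_⟩
    · rcases hB with hB | ⟨A, hA, hAB⟩
      · exact .inl hB
      · exact .inr (.inr ⟨A, hmem _ hA, hmem _ hAB⟩)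
    · rcases hZ hD with rfl | hD
      · simp
      · simp [hmem D hD]

theorem Gen.exists_provesIn {Sch : Finset Formula} {A : Formula} {K : ℕ}
    (h : Gen (FregeRule Sch) ∅ {A} K) : ∃ N ≤ K, ProvesIn Sch A N := by
  obtain ⟨L, hL, hlen, hmem⟩ := h.exists_isDerivation
  obtain ⟨L₁, L₂, rfl⟩ := List.append_of_mem (hmem A rfl)
  refine ⟨L₁.length + 1, by simp at hlen; omega, L₁ ++ [A], ?_, by simp, by simp⟩
  exact IsDerivation.left (L' := L₂) (by simpa using hL)

/-- A single derivation of `B` from `Γ` works schematically: substitution preserves axioms and modus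
ponens, so its length bounds the cost of all instances. -/
theorem IsFregeSystem.exists_gen {k : ℕ} {Sch : Finset Formula} (hSch : IsFregeSystem k Sch)
    {Γ : Set Formula} {B : Formula} (hΓ : Γ.Finite) (h : Entails k Γ B) :
    ∃ c, ∀ (σ : ℕ → Formula) (X : Set Formula), (∀ A ∈ Γ, A.subst σ ∈ X) →
      Gen (FregeRule Sch) X {B.subst σ} c := by
  obtain ⟨n, L, hL, hlast, -⟩ := hSch.complete Γ B hΓ h
  refine ⟨L.length, fun σ X hX => (hL.gen_subst σ hX).mono ?_⟩
  exact Set.singleton_subset_iff.2 (.inr ⟨B, List.mem_of_getLast? hlast, rfl⟩)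

/-! ### Truth values and the iterated implication -/

theorem Formula.eval_values {k : ℕ} (hk : 2 ≤ k) {v : ℕ → ℚ} (hv : IsValuation k v)
    (A : Formula) : ∃ j : ℕ, j < k ∧ A.eval v = (j : ℚ) / ((k : ℚ) - 1) := by
  have hk' : (0 : ℚ) < (k : ℚ) - 1 := by
    have : (2 : ℚ) ≤ k := by exact_mod_cast hk
    linarith
  induction A with
  | var p => exact hv p
  | conj A B ihA ihB =>
    rw [Formula.eval]
    rcases min_choice (A.eval v) (B.eval v) with h | h <;> rw [h]
    · exact ihA
    · exact ihB
  | disj A B ihA ihB =>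
    rw [Formula.eval]
    rcases max_choice (A.eval v) (B.eval v) with h | h <;> rw [h]
    · exact ihA
    · exact ihB
  | imp A B ihA ihB =>
    obtain ⟨a, ha, hA⟩ := ihA
    obtain ⟨b, hb, hB⟩ := ihB
    rw [Formula.eval, hA, hB]
    rcases le_total a b with hab | hab
    · refine ⟨k - 1, by omega, ?_⟩
      rw [Nat.cast_sub (by omega), Nat.cast_one, div_self hk'.ne', min_eq_left]
      have : (a : ℚ) / (k - 1) ≤ b / (k - 1) := by gcongr
      linarith
    · refine ⟨k - 1 - a + b, by omega, ?_⟩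
      rw [min_eq_right]
      · rw [Nat.cast_add, Nat.cast_sub (by omega), Nat.cast_sub (by omega), Nat.cast_one]
        field_simp
      · have : (b : ℚ) / (k - 1) ≤ a / (k - 1) := by gcongr
        linarith
  | neg A ihA =>
    obtain ⟨a, ha, hA⟩ := ihA
    refine ⟨k - 1 - a, by omega, ?_⟩
    rw [Formula.eval, hA, Nat.cast_sub (by omega), Nat.cast_sub (by omega), Nat.cast_one]
    field_simp

theorem Formula.eval_mem_unit {k : ℕ} (hk : 2 ≤ k) {v : ℕ → ℚ} (hv : IsValuation k v)
    (A : Formula) : 0 ≤ A.eval v ∧ A.eval v ≤ 1 ∧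
      (A.eval v ≠ 1 → 1 ≤ ((k - 1 : ℕ) : ℚ) * (1 - A.eval v)) := by
  obtain ⟨j, hj, hA⟩ := A.eval_values hk hv
  have hk' : (0 : ℚ) < (k : ℚ) - 1 := by
    have : (2 : ℚ) ≤ k := by exact_mod_cast hk
    linarith
  have hj' : (j : ℚ) ≤ k - 1 := by
    have : ((j + 1 : ℕ) : ℚ) ≤ k := by exact_mod_cast hj
    push_cast at this
    linarith
  rw [hA]
  refine ⟨by positivity, by rw [div_le_one hk']; exact hj', fun hne => ?_⟩
  have hj1 : j + 1 ≠ k := by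
    rintro rfl
    apply hne
    push_cast
    rw [add_sub_cancel_right]
    push_cast at hk'
    exact div_self (by linarith)
  have hj2 : (j : ℚ) + 2 ≤ k := by
    have : j + 2 ≤ k := by omega
    exact_mod_cast this
  rw [Nat.cast_sub (by omega), Nat.cast_one, mul_sub, mul_one, mul_div_cancel₀ _ hk'.ne']
  linarith

/-- The `j`-fold implication `A ⊃ (A ⊃ … ⊃ (A ⊃ B))`. -/
def Formula.impIter : ℕ → Formula → Formula → Formula
  | 0, _, B => B
  | j + 1, A, B => .imp A (impIter j A B)

theorem Formula.subst_impIter (σ : ℕ → Formula) (j : ℕ) (A B : Formula) :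
    (impIter j A B).subst σ = impIter j (A.subst σ) (B.subst σ) := by
  induction j with
  | zero => rfl
  | succ j ih => rw [impIter, Formula.subst, ih, impIter]

theorem Formula.eval_impIter (v : ℕ → ℚ) (j : ℕ) (A B : Formula) (hA : A.eval v ≤ 1)
    (hB : B.eval v ≤ 1) :
    (impIter j A B).eval v = min 1 ((j : ℚ) * (1 - A.eval v) + B.eval v) := by
  induction j with
  | zero => simp [impIter, hB]
  | succ j ih =>
    rw [impIter, Formula.eval, ih]
    push_cast
    rcases le_total 1 ((j : ℚ) * (1 - A.eval v) + B.eval v) with h | h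
    · rw [min_eq_left h, min_eq_left (by linarith), min_eq_left (by linarith)]
    · rw [min_eq_right h]
      congr 1
      ring

/-- Each copy of the premise adds its distance from 1, up to the maximum 1. A nonzero distance is at
least `1/(k-1)`, so `k - 1` copies reach 1. -/
theorem Formula.eval_impIter_eq_one {k : ℕ} (hk : 2 ≤ k) {v : ℕ → ℚ} (hv : IsValuation k v)
    (A B : Formula) :
    (impIter (k - 1) A B).eval v = 1 ↔ (A.eval v = 1 → B.eval v = 1) := by
  obtain ⟨hA0, hA1, hA2⟩ := A.eval_mem_unit hk hv
  obtain ⟨hB0, hB1, -⟩ := B.eval_mem_unit hk hv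
  rw [eval_impIter v _ A B hA1 hB1]
  by_cases h : A.eval v = 1
  · simp [h, hB1]
  · have := hA2 h
    simp only [h, false_imp_iff, iff_true]
    exact min_eq_left (by linarith)

/-! ### Constant-cost rules for implications from a context -/

/-- Substitution of four given formulas for the variables. -/
def subst₄ (A B C D : Formula) : ℕ → Formula
  | 0 => A
  | 1 => B
  | 2 => C
  | _ => D

/-- An implication whose value is `1` precisely if the designated value `1` passes from the
premise to the conclusion. -/
def strongImp (k : ℕ) (A B : Formula) : Formula := Formula.impIter (k - 1) A B

/-- The conjunction of the open assumptions. -/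
def ctxFormula (Γ : List Formula) : Formula :=
  Γ.foldl Formula.conj (.imp (.var 0) (.var 0))

theorem ctxFormula_snoc (Γ : List Formula) (A : Formula) :
    ctxFormula (Γ ++ [A]) = .conj (ctxFormula Γ) A := by
  simp [ctxFormula]

/-- The Frege system derives the rules for `strongImp` in at most `c` steps each. -/
structure RuleCosts (Sch : Finset Formula) (k c : ℕ) : Prop where
  trans : ∀ {X : Set Formula} {A B C : Formula}, strongImp k A B ∈ X → strongImp k B C ∈ X →
    Gen (FregeRule Sch) X {strongImp k A C} c
  mp : ∀ {X : Set Formula} {G A B : Formula}, strongImp k G A ∈ X →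
    strongImp k G (.imp A B) ∈ X → Gen (FregeRule Sch) X {strongImp k G B} c
  weaken : ∀ {X : Set Formula} (G : Formula) {A : Formula}, A ∈ X →
    Gen (FregeRule Sch) X {strongImp k G A} c
  left : ∀ (X : Set Formula) (G A : Formula),
    Gen (FregeRule Sch) X {strongImp k (.conj G A) G} c
  right : ∀ (X : Set Formula) (G A : Formula),
    Gen (FregeRule Sch) X {strongImp k (.conj G A) A} c
  orElim : ∀ {X : Set Formula} {G A B C : Formula},
    strongImp k G (.disj A B) ∈ X ∨ strongImp k G (.disj B A) ∈ X →
    strongImp k (.conj G A) C ∈ X → strongImp k (.conj G B) C ∈ X →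
    Gen (FregeRule Sch) X {strongImp k G C} c
  top : ∀ (X : Set Formula) (G : Formula),
    Gen (FregeRule Sch) X {strongImp k G (ctxFormula [])} c
  discharge : ∀ {X : Set Formula} {A : Formula}, strongImp k (ctxFormula []) A ∈ X →
    Gen (FregeRule Sch) X {A} c

theorem IsFregeSystem.exists_ruleCosts {k : ℕ} {Sch : Finset Formula} (hk : 2 ≤ k)
    (hSch : IsFregeSystem k Sch) : ∃ c, RuleCosts Sch k c := by
  have key : ∀ (Γ : List Formula) (B : Formula),
      (∀ v, IsValuation k v → (∀ A ∈ Γ, A.eval v = 1) → B.eval v = 1) →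
      ∃ c, ∀ (σ : ℕ → Formula) (X : Set Formula), (∀ A ∈ Γ, A.subst σ ∈ X) →
        Gen (FregeRule Sch) X {B.subst σ} c := fun Γ B h =>
    hSch.exists_gen (Γ := {A | A ∈ Γ}) Γ.finite_toSet h
  have ev : ∀ {v : ℕ → ℚ}, IsValuation k v → ∀ A B : Formula,
      ((strongImp k A B).eval v = 1 ↔ (A.eval v = 1 → B.eval v = 1)) := fun hv A B =>
    Formula.eval_impIter_eq_one hk hv A B
  have evc : ∀ {v : ℕ → ℚ}, IsValuation k v → ∀ A B : Formula,
      ((A.conj B).eval v = 1 ↔ A.eval v = 1 ∧ B.eval v = 1) := fun hv A B => by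
    have hA := (A.eval_mem_unit hk hv).2.1
    have hB := (B.eval_mem_unit hk hv).2.1
    rw [Formula.eval]
    constructor
    · intro h
      exact ⟨le_antisymm hA (h ▸ min_le_left _ _), le_antisymm hB (h ▸ min_le_right _ _)⟩
    · rintro ⟨h1, h2⟩
      rw [h1, h2, min_self]
  -- Since the truth values are linearly ordered, a designated disjunction has a designated
  -- disjunct; this makes disjunction elimination sound.
  have evd : ∀ {v : ℕ → ℚ} (A B : Formula), (A.disj B).eval v = 1 →
      A.eval v = 1 ∨ B.eval v = 1 := fun {v} A B h => by
    rw [Formula.eval] at h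
    rcases max_choice (A.eval v) (B.eval v) with h' | h' <;> rw [h'] at h
    · exact .inl h
    · exact .inr h
  have evt : ∀ (v : ℕ → ℚ), (ctxFormula []).eval v = 1 := fun v => by
    simp [ctxFormula, Formula.eval]
  have sub : ∀ (σ : ℕ → Formula) (A B : Formula),
      (strongImp k A B).subst σ = strongImp k (A.subst σ) (B.subst σ) := fun σ A B =>
    Formula.subst_impIter σ _ A B
  obtain ⟨c₁, h₁⟩ := key [strongImp k (.var 0) (.var 1), strongImp k (.var 1) (.var 2)]
    (strongImp k (.var 0) (.var 2)) (fun v hv h => by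
      simp only [List.forall_mem_cons, ev hv] at h ⊢
      tauto)
  obtain ⟨c₂, h₂⟩ := key [strongImp k (.var 0) (.var 1),
      strongImp k (.var 0) (.imp (.var 1) (.var 2))]
    (strongImp k (.var 0) (.var 2)) (fun v hv h => by
      simp only [List.forall_mem_cons, ev hv] at h ⊢
      intro h0
      have h1 := h.1 h0
      have h2 := h.2.1 h0
      have h3 := (Formula.eval_mem_unit hk hv (.var 2)).2.1
      rwa [Formula.eval, h1, sub_self, zero_add, min_eq_right h3] at h2)
  obtain ⟨c₃, h₃⟩ := key [.var 1] (strongImp k (.var 0) (.var 1)) (fun v hv h => by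
      simp only [List.forall_mem_cons, ev hv] at h ⊢
      tauto)
  obtain ⟨c₄, h₄⟩ := key [] (strongImp k (.conj (.var 0) (.var 1)) (.var 0)) (fun v hv h => by
      rw [ev hv, evc hv]
      tauto)
  obtain ⟨c₅, h₅⟩ := key [] (strongImp k (.conj (.var 0) (.var 1)) (.var 1)) (fun v hv h => by
      rw [ev hv, evc hv]
      tauto)
  obtain ⟨c₆, h₆⟩ := key [strongImp k (.var 0) (.disj (.var 1) (.var 2)),
      strongImp k (.conj (.var 0) (.var 1)) (.var 3),
      strongImp k (.conj (.var 0) (.var 2)) (.var 3)]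
    (strongImp k (.var 0) (.var 3)) (fun v hv h => by
      simp only [List.forall_mem_cons, ev hv, evc hv] at h ⊢
      intro h0
      rcases evd _ _ (h.1 h0) with h1 | h1
      · exact h.2.1 ⟨h0, h1⟩
      · exact h.2.2.1 ⟨h0, h1⟩)
  obtain ⟨c₇, h₇⟩ := key [] (strongImp k (.var 1) (.imp (.var 0) (.var 0))) (fun v hv h => by
      rw [ev hv]
      exact fun _ => evt v)
  obtain ⟨c₈, h₈⟩ := key [strongImp k (.imp (.var 0) (.var 0)) (.var 1)] (.var 1)
    (fun v hv h => by
      simp only [List.forall_mem_cons, ev hv] at h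
      exact h.1 (evt v))
  simp only [List.forall_mem_cons, List.not_mem_nil, false_imp_iff, implies_true, and_true,
    sub, Formula.subst, and_imp, forall_const] at h₁ h₂ h₃ h₄ h₅ h₆ h₇ h₈
  refine ⟨c₁ + c₂ + c₃ + c₄ + c₅ + c₆ + c₇ + c₈, ?_, ?_, ?_, ?_, ?_, ?_, ?_, ?_⟩
  · intro X A B C hA hB
    exact (h₁ (subst₄ A B C C) X hA hB).mono_cost (by omega)
  · intro X G A B hA hB
    exact (h₂ (subst₄ G A B B) X hA hB).mono_cost (by omega)
  · intro X G A hA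
    exact (h₃ (subst₄ G A A A) X hA).mono_cost (by omega)
  · intro X G A
    exact (h₄ (subst₄ G A A A) X).mono_cost (by omega)
  · intro X G A
    exact (h₅ (subst₄ G A A A) X).mono_cost (by omega)
  · rintro X G A B C (hd | hd) hA hB
    · exact (h₆ (subst₄ G A B C) X hd hA hB).mono_cost (by omega)
    · exact (h₆ (subst₄ G B A C) X hd hB hA).mono_cost (by omega)
  · intro X G
    exact (h₇ (subst₄ (.var 0) G G G) X).mono_cost (by omega)
  · intro X A hA
    exact (h₈ (subst₄ (.var 0) A A A) X hA).mono_cost (by omega)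

/-! ### Translating nested proofs -/

/-- The contexts of a segment that differ from its own one are at most as many as the openings of
assumptions, and each of them extends another context by one formula. -/
theorem NestedSegment.exists_contexts {Sch : Finset Formula} {Γ : List Formula}
    {Δ Δ' : Set Formula} {s : List Sequent} {m : ℕ} (h : NestedSegment Sch Γ Δ s Δ' m) :
    m ≤ s.length ∧ ∃ F : Finset (List Formula), F.card ≤ m ∧
      (∀ S ∈ s, S.ctx = Γ ∨ S.ctx ∈ F) ∧
      ∀ w ∈ F, ∃ G A, w = G ++ [A] ∧ (G = Γ ∨ G ∈ F) := by
  classical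
  induction h with
  | nil Γ Δ => exact ⟨le_rfl, ∅, by simp, by simp, by simp⟩
  | ax _ _ ih =>
    obtain ⟨hm, F, h1, h2, h3⟩ := ih
    refine ⟨by simp; omega, F, h1, fun S hS => ?_, h3⟩
    rcases List.mem_append.1 hS with hS | hS
    · exact h2 S hS
    · rw [List.mem_singleton] at hS
      exact .inl (by rw [hS])
  | mp _ _ _ ih =>
    obtain ⟨hm, F, h1, h2, h3⟩ := ih
    refine ⟨by simp; omega, F, h1, fun S hS => ?_, h3⟩
    rcases List.mem_append.1 hS with hS | hS
    · exact h2 S hS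
    · rw [List.mem_singleton] at hS
      exact .inl (by rw [hS])
  | @orElim Γ Δ Δ' Δ₁ Δ₂ s s₁ s₂ m m₁ m₂ A B C _ _ _ _ _ _ ih ih₁ ih₂ =>
    obtain ⟨hm, F, h1, h2, h3⟩ := ih
    obtain ⟨hm₁, F₁, h1₁, h2₁, h3₁⟩ := ih₁
    obtain ⟨hm₂, F₂, h1₂, h2₂, h3₂⟩ := ih₂
    refine ⟨by simp; omega, F ∪ (insert (Γ ++ [A]) F₁ ∪ insert (Γ ++ [B]) F₂), ?_, ?_, ?_⟩
    · have e1 := Finset.card_union_le F (insert (Γ ++ [A]) F₁ ∪ insert (Γ ++ [B]) F₂)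
      have e2 := Finset.card_union_le (insert (Γ ++ [A]) F₁) (insert (Γ ++ [B]) F₂)
      have e3 := Finset.card_insert_le (Γ ++ [A]) F₁
      have e4 := Finset.card_insert_le (Γ ++ [B]) F₂
      omega
    · intro S hS
      simp only [List.mem_append, List.mem_cons, List.not_mem_nil, or_false] at hS
      simp only [Finset.mem_union, Finset.mem_insert]
      rcases hS with ((hS | rfl | hS) | rfl | hS) | rfl
      · have := h2 S hS; tauto
      · simp
      · have := h2₁ S hS; tauto
      · simp
      · have := h2₂ S hS; tauto
      · simp
    · intro w hw
      simp only [Finset.mem_union, Finset.mem_insert] at hw ⊢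
      rcases hw with hw | (rfl | hw) | rfl | hw
      · obtain ⟨G, D, rfl, hG⟩ := h3 w hw
        exact ⟨G, D, rfl, by tauto⟩
      · exact ⟨Γ, A, rfl, .inl rfl⟩
      · obtain ⟨G, D, rfl, hG⟩ := h3₁ w hw
        exact ⟨G, D, rfl, by tauto⟩
      · exact ⟨Γ, B, rfl, .inl rfl⟩
      · obtain ⟨G, D, rfl, hG⟩ := h3₂ w hw
        exact ⟨G, D, rfl, by tauto⟩

/-- Every formula of `Δ` is available in `X` relative to some context in `V` that is a prefix
of `Γ`. -/
def Available (k : ℕ) (V : Set (List Formula)) (X : Set Formula) (Γ : List Formula)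
    (Δ : Set Formula) : Prop :=
  ∀ B ∈ Δ, ∃ Γ₁ ∈ V, Γ₁ <+: Γ ∧ strongImp k (ctxFormula Γ₁) B ∈ X

theorem Available.mono {k : ℕ} {V : Set (List Formula)} {X Y : Set Formula}
    {Γ Γ' : List Formula} {Δ : Set Formula} (h : Available k V X Γ Δ) (hX : X ⊆ Y)
    (hΓ : Γ <+: Γ') : Available k V Y Γ' Δ := fun B hB => by
  obtain ⟨Γ₁, h1, h2, h3⟩ := h B hB
  exact ⟨Γ₁, h1, h2.trans hΓ, hX h3⟩

theorem Available.insert {k : ℕ} {V : Set (List Formula)} {X : Set Formula}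
    {Γ : List Formula} {Δ : Set Formula} {A : Formula} (h : Available k V X Γ Δ) (hΓ : Γ ∈ V)
    (hA : strongImp k (ctxFormula Γ) A ∈ X) : Available k V X Γ (insert A Δ) := by
  rintro B (rfl | hB)
  · exact ⟨Γ, hΓ, List.prefix_rfl, hA⟩
  · exact h B hB

/-- Here `q` is the price of moving a formula from a prefix context to the current one. A sequent
costs at most two such moves, one translated rule and one axiom, hence `c + 2 * q + 1`. Formulas
from closed blocks stay derived, which is harmless. The last clause is separate because `Available`
only promises some prefix context, whereas a block must deliver its conclusion in its own context.
-/
theorem NestedSegment.exists_gen {Sch : Finset Formula} {k c q : ℕ} (hc : RuleCosts Sch k c)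
    {V : Set (List Formula)} {Base : Set Formula}
    (hq : ∀ X, Base ⊆ X → ∀ Γ ∈ V, ∀ Γ₁ ∈ V, Γ₁ <+: Γ → ∀ B,
      strongImp k (ctxFormula Γ₁) B ∈ X →
      Gen (FregeRule Sch) X {strongImp k (ctxFormula Γ) B} q)
    {Γ : List Formula} {Δ Δ' : Set Formula} {s : List Sequent} {m : ℕ}
    (h : NestedSegment Sch Γ Δ s Δ' m) (hΓ : Γ ∈ V) (hs : ∀ S ∈ s, S.ctx ∈ V)
    {X : Set Formula} (hX : Base ⊆ X) (hav : Available k V X Γ Δ) :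
    ∃ Y, X ⊆ Y ∧ Gen (FregeRule Sch) X Y ((c + 2 * q + 1) * s.length) ∧ Available k V Y Γ Δ' ∧
      ∀ C, s.getLast? = some ⟨Γ, C⟩ → strongImp k (ctxFormula Γ) C ∈ Y := by
  have ext : ∀ {X Y Z : Set Formula} {K K' : ℕ}, X ⊆ Y → Gen (FregeRule Sch) X Y K →
      Gen (FregeRule Sch) Y Z K' → Gen (FregeRule Sch) X (Y ∪ Z) (K + K') :=
    fun _ h1 h2 => h1.trans ((h2.union FregeRule.mono subset_rfl).mono (by rw [Set.union_comm]))
  have query : ∀ {X : Set Formula} {Γ : List Formula} {Δ : Set Formula} {B : Formula},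
      Base ⊆ X → Γ ∈ V → Available k V X Γ Δ → B ∈ Δ →
      Gen (FregeRule Sch) X {strongImp k (ctxFormula Γ) B} q := by
    intro X Γ Δ B hX hΓ hav hB
    obtain ⟨Γ₁, h1, h2, h3⟩ := hav B hB
    exact hq X hX Γ hΓ Γ₁ h1 h2 B h3
  induction h generalizing X with
  | nil Γ Δ => exact ⟨X, subset_rfl, .base subset_rfl, hav, fun C h => by simp at h⟩
  | @ax Γ Δ Δ' s m A _ hA ih =>
    obtain ⟨Y, hXY, hY, hav', -⟩ := ih hΓ (fun S hS => hs S (by simp [hS])) hX hav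
    have g1 : Gen (FregeRule Sch) Y (Y ∪ {A}) 1 :=
      .step (.base (K := 0) (Y := Y) subset_rfl) (.inl hA) (by rw [Set.union_singleton])
    have g2 := ext (hXY.trans Set.subset_union_left) (hY.trans g1)
      (hc.weaken (X := Y ∪ {A}) (ctxFormula Γ) (A := A) (.inr rfl))
    refine ⟨_, hXY.trans (Set.subset_union_left.trans Set.subset_union_left),
      g2.mono_cost ?_, ?_, ?_⟩
    · rw [List.length_append, List.length_singleton, mul_add]
      omega
    · exact (hav'.mono (Set.subset_union_left.trans Set.subset_union_left)
        List.prefix_rfl).insert hΓ (.inr rfl)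
    · intro C hC
      simp only [List.getLast?_append, List.getLast?_singleton, Option.some_or, Option.some.injEq,
        Sequent.mk.injEq, true_and] at hC
      exact hC ▸ .inr rfl
  | @mp Γ Δ Δ' s m A B _ hA hAB ih =>
    obtain ⟨Y, hXY, hY, hav', -⟩ := ih hΓ (fun S hS => hs S (by simp [hS])) hX hav
    have g1 := ext hXY hY (query (hX.trans hXY) hΓ hav' hA)
    have hXY₁ := hXY.trans (Set.subset_union_left (t := {strongImp k (ctxFormula Γ) A}))
    have hav₁ := hav'.mono (Set.subset_union_left (t := {strongImp k (ctxFormula Γ) A}))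
      List.prefix_rfl
    have g2 := ext hXY₁ g1 (query (hX.trans hXY₁) hΓ hav₁ hAB)
    have hXY₂ := hXY₁.trans
      (Set.subset_union_left (t := {strongImp k (ctxFormula Γ) (.imp A B)}))
    have g3 := ext hXY₂ g2 (hc.mp (.inl (.inr rfl)) (.inr rfl))
    refine ⟨_, hXY₂.trans Set.subset_union_left, g3.mono_cost ?_, ?_, ?_⟩
    · rw [List.length_append, List.length_singleton, mul_add]
      omega
    · exact (hav₁.mono (Set.subset_union_left.trans Set.subset_union_left)
        List.prefix_rfl).insert hΓ (.inr rfl)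
    · intro C hC
      simp only [List.getLast?_append, List.getLast?_singleton, Option.some_or, Option.some.injEq,
        Sequent.mk.injEq, true_and] at hC
      exact hC ▸ .inr rfl
  | @orElim Γ Δ Δ' Δ₁ Δ₂ s s₁ s₂ m m₁ m₂ A B C _ hd _ hl₁ _ hl₂ ih ih₁ ih₂ =>
    -- Opening `D` is simulated by the projection from `ctxFormula Γ ∧ D` to `D`, at cost `c`. If
    -- nothing follows the opening, then `C = D` and this projection is already the result.
    have block : ∀ (s : List Sequent) (Δ₁ : Set Formula) (D : Formula),
        Γ ++ [D] ∈ V → (⟨Γ ++ [D], D⟩ :: s).getLast? = some ⟨Γ ++ [D], C⟩ →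
        (∀ {X : Set Formula}, Base ⊆ X → Available k V X (Γ ++ [D]) (insert D Δ') →
          ∃ Y, X ⊆ Y ∧ Gen (FregeRule Sch) X Y ((c + 2 * q + 1) * s.length) ∧
            Available k V Y (Γ ++ [D]) Δ₁ ∧
            ∀ C, s.getLast? = some ⟨Γ ++ [D], C⟩ →
              strongImp k (ctxFormula (Γ ++ [D])) C ∈ Y) →
        ∀ {X : Set Formula}, Base ⊆ X → Available k V X Γ Δ' →
          ∃ Y, X ⊆ Y ∧ Gen (FregeRule Sch) X Y (c + (c + 2 * q + 1) * s.length) ∧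
            strongImp k (.conj (ctxFormula Γ) D) C ∈ Y := by
      intro s Δ₁ D hD hl ih X hX hav
      have g1 := ext subset_rfl (.base (K := 0) subset_rfl) (hc.right X (ctxFormula Γ) D)
      have hsub := Set.subset_union_left (s := X)
        (t := {strongImp k (.conj (ctxFormula Γ) D) D})
      obtain ⟨Y, hXY, hY, -, hlast⟩ := ih (hX.trans hsub)
        ((hav.mono hsub (List.prefix_append _ _)).insert hD
          (by rw [ctxFormula_snoc]; exact .inr rfl))
      refine ⟨Y, hsub.trans hXY, (g1.trans hY).mono_cost (by omega), ?_⟩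
      rcases List.eq_nil_or_concat s with rfl | ⟨s', S, rfl⟩
      · simp only [List.getLast?_singleton, Option.some.injEq, Sequent.mk.injEq, true_and] at hl
        subst hl
        exact hXY (.inr rfl)
      · rw [← ctxFormula_snoc]
        refine hlast C ?_
        rw [← hl, List.concat_eq_append, ← List.cons_append, List.getLast?_append,
          List.getLast?_append]
        simp
    obtain ⟨Y, hXY, hY, hav', -⟩ := ih hΓ (fun S hS => hs S (by simp [hS])) hX hav
    have hA : Γ ++ [A] ∈ V := hs ⟨Γ ++ [A], A⟩ (by simp)
    have hB : Γ ++ [B] ∈ V := hs ⟨Γ ++ [B], B⟩ (by simp)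
    obtain ⟨Y₁, hXY₁, hY₁, hC₁⟩ := block s₁ Δ₁ A hA hl₁
      (ih₁ hA (fun S hS => hs S (by simp [hS]))) (hX.trans hXY) hav'
    have hav₁ := hav'.mono hXY₁ List.prefix_rfl
    obtain ⟨Y₂, hXY₂, hY₂, hC₂⟩ := block s₂ Δ₂ B hB hl₂
      (ih₂ hB (fun S hS => hs S (by simp [hS]))) ((hX.trans hXY).trans hXY₁) hav₁
    have hav₂ := hav₁.mono hXY₂ List.prefix_rfl
    have hXY' := (hXY.trans hXY₁).trans hXY₂
    obtain ⟨D, hD, hDor⟩ : ∃ D ∈ Δ', D = .disj A B ∨ D = .disj B A := by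
      rcases hd with hd | hd
      · exact ⟨_, hd, .inl rfl⟩
      · exact ⟨_, hd, .inr rfl⟩
    have g1 := ext hXY' ((hY.trans hY₁).trans hY₂) (query (hX.trans hXY') hΓ hav₂ hD)
    have hXY₃ := hXY'.trans (Set.subset_union_left (t := {strongImp k (ctxFormula Γ) D}))
    have g2 := ext hXY₃ g1 (hc.orElim (G := ctxFormula Γ) (A := A) (B := B) (C := C)
      (hDor.imp (fun h => .inr (by rw [h]; rfl)) fun h => .inr (by rw [h]; rfl))
      (.inl (hXY₂ hC₁)) (.inl hC₂))
    refine ⟨_, hXY₃.trans Set.subset_union_left, g2.mono_cost ?_, ?_, ?_⟩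
    · simp only [List.length_append, List.length_cons, List.length_nil, mul_add]
      omega
    · exact (hav₂.mono (Set.subset_union_left.trans Set.subset_union_left)
        List.prefix_rfl).insert hΓ (.inr rfl)
    · intro C' hC
      simp only [List.getLast?_append, List.getLast?_singleton, Option.some_or, Option.some.injEq,
        Sequent.mk.injEq, true_and] at hC
      exact hC ▸ .inr rfl

/-! ### The forest of contexts and the final count -/

/-- `u` is a context of which `w` is a proper extension. -/
def ctxLt (w u : List Formula) : Prop := u <+: w ∧ u ≠ w

theorem isForest_ctxLt : IsForest ctxLt where
  irrefl a h := h.2 rfl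
  trans := by
    rintro a b c ⟨h1, h2⟩ ⟨h3, h4⟩
    refine ⟨h3.trans h1, ?_⟩
    rintro rfl
    exact h2 (h1.eq_of_length_le h3.length_le)
  chain := by
    rintro a b c ⟨h1, -⟩ ⟨h2, -⟩
    by_cases h : b = c
    · exact .inr (.inl h)
    · rcases List.prefix_or_prefix_of_prefix h1 h2 with h3 | h3
      · exact .inr (.inr ⟨h3, h⟩)
      · exact .inl ⟨h3, Ne.symm h⟩

theorem HasPath.gen {Sch : Finset Formula} {k c : ℕ} (hc : RuleCosts Sch k c)
    {Z : Set (List Formula × List Formula)} {X : Set Formula}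
    (hX : ∀ e ∈ Z, strongImp k (ctxFormula e.1) (ctxFormula e.2) ∈ X) {ℓ : ℕ}
    {Γ Γ₁ : List Formula} (h : HasPath Z ℓ Γ Γ₁) {B : Formula}
    (hB : strongImp k (ctxFormula Γ₁) B ∈ X) :
    Gen (FregeRule Sch) X {strongImp k (ctxFormula Γ) B} (c * ℓ) := by
  induction ℓ generalizing Γ with
  | zero =>
    obtain rfl : Γ = Γ₁ := h
    exact .base (Set.singleton_subset_iff.2 hB)
  | succ ℓ ih =>
    obtain ⟨Γ₂, rfl | h2, h⟩ := h
    · exact (ih h).mono_cost (by gcongr; omega)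
    · exact ((ih h).extend FregeRule.mono
        (hc.trans (.inl (hX _ h2)) (.inr rfl))).mono Set.subset_union_right

/-- The projections from contexts to their immediate predecessors. -/
theorem gen_coverPairs {Sch : Finset Formula} {k c : ℕ} (hc : RuleCosts Sch k c)
    (F : Finset (List Formula)) (hF : ∀ w ∈ F, ∃ G A, w = G ++ [A] ∧ (G = [] ∨ G ∈ F)) :
    Gen (FregeRule Sch) ∅
      ((fun e : List Formula × List Formula => strongImp k (ctxFormula e.1) (ctxFormula e.2)) ''
        coverPairs ctxLt F) (c * F.card) := by
  classical
  have key : ∀ F' : Finset (List Formula), (∀ w ∈ F', ∃ G A, w = G ++ [A]) →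
      Gen (FregeRule Sch) ∅ {B | ∃ G A, G ++ [A] ∈ F' ∧
        B = strongImp k (ctxFormula (G ++ [A])) (ctxFormula G)} (c * F'.card) := by
    intro F'
    induction F' using Finset.induction_on with
    | empty => exact fun _ => .base (by simp)
    | insert w F' hw ih =>
      intro h
      obtain ⟨G, A, rfl⟩ := h w (Finset.mem_insert_self _ _)
      have g := (ih fun w hw => h w (Finset.mem_insert_of_mem hw)).extend FregeRule.mono
        (hc.left _ (ctxFormula G) A)
      rw [Finset.card_insert_of_notMem hw, mul_add, mul_one]
      refine g.mono ?_
      rintro B ⟨G', A', hm, rfl⟩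
      rcases Finset.mem_insert.1 hm with heq | hm
      · obtain ⟨rfl, -⟩ := List.append_inj' heq rfl
        rw [heq, ctxFormula_snoc]
        exact .inr rfl
      · exact .inl (.inr ⟨G', A', hm, rfl⟩)
  refine (key F fun w hw => (hF w hw).imp fun G h => h.imp fun A h => h.1).mono ?_
  rintro _ ⟨⟨w, u⟩, ⟨hw, hu, ⟨hpre, hne⟩, hcov⟩, rfl⟩
  obtain ⟨G, A, hwG, hG⟩ := hF w hw
  obtain ⟨Gu, Au, huG, -⟩ := hF u hu
  simp only at hwG huG hpre hne hcov hw
  have huG' : u <+: G := by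
    rw [hwG, List.prefix_concat_iff] at hpre
    exact hpre.resolve_left fun h => hne (by rw [h, hwG])
  -- The immediate predecessor `G` of `w` is either empty or in `F`, so a neighbour `u` of `w` in
  -- `F` cannot be shorter than `G`.
  have hGu : u = G := by
    by_contra hcon
    rcases hG with rfl | hG
    · exact hcon (List.prefix_nil.1 huG')
    · exact hcov G hG ⟨⟨⟨[A], hwG.symm⟩, fun h => by
        have := congrArg List.length (h.trans hwG)
        simp at this⟩, huG', hcon⟩
  exact ⟨G, A, hwG ▸ hw, by rw [hwG, hGu]⟩

/-- The bound `p` on `m` is kept free so that the logarithm can be taken at `n` in part (1) and at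
`m` in part (2), without any monotonicity of `logStar`. The dependence on `i` is explicit, since
part (1) lets `i` grow with `n`. -/
theorem NestedProvesIn.exists_provesIn {Sch : Finset Formula} {k c : ℕ}
    (hc : RuleCosts Sch k c) (i : ℕ) {A : Formula} {n m p : ℕ} (h : NestedProvesIn Sch A n m)
    (hp : m ≤ p) :
    ∃ N, N ≤ 15 * (c + 1) * ((i + 1) * (n + m * logStar i p)) ∧ ProvesIn Sch A N := by
  obtain ⟨s, Δ, hseg, hlast, rfl⟩ := h
  obtain ⟨hms, F, hFcard, hFctx, hF⟩ := hseg.exists_contexts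
  obtain ⟨Z, hZ, hpath⟩ := hasShortcuts_logStar (List Formula) i ctxLt isForest_ctxLt F p
    fun u hu => by
      -- An element is not its own descendant, so the count is strictly below `F.card ≤ m ≤ p`.
      refine lt_of_lt_of_le (ncard_sep_lt F (q := fun _ => True) (fun _ _ _ => trivial) u hu
        trivial (isForest_ctxLt.irrefl u)) ?_
      have : {w | w ∈ F ∧ True} = (F : Set (List Formula)) := by ext; simp
      rw [this, Set.ncard_coe_finset]
      omega
  set f : List Formula × List Formula → Formula :=
    fun e => strongImp k (ctxFormula e.1) (ctxFormula e.2) with hf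
  have gZ : Gen (FregeRule Sch) ∅ (f '' Z) (c * F.card +
      c * ((6 + 3 * i) * (F.card * logStar i p))) := by
    refine (gen_coverPairs hc F hF).trans (Gen.image FregeRule.mono f c ?_ hZ)
    rintro S ⟨a, b⟩ T ⟨d, h1, h2⟩ hST
    have e1 := hST (Set.mem_image_of_mem f h1)
    have e2 := hST (Set.mem_image_of_mem f h2)
    exact hc.trans e1 e2
  have hq : ∀ X, f '' Z ⊆ X → ∀ Γ ∈ insert [] (F : Set (List Formula)),
      ∀ Γ₁ ∈ insert [] (F : Set (List Formula)), Γ₁ <+: Γ → ∀ B,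
      strongImp k (ctxFormula Γ₁) B ∈ X →
      Gen (FregeRule Sch) X {strongImp k (ctxFormula Γ) B} (c * (3 + 2 * i)) := by
    intro X hX Γ hΓ Γ₁ hΓ₁ hpre B hB
    by_cases heq : Γ₁ = Γ
    · exact .base (Set.singleton_subset_iff.2 (heq ▸ hB))
    -- The empty context needs no shortcuts: its formula is a tautology, so every context implies it
    -- at constant cost.
    rcases hΓ₁ with rfl | hΓ₁
    · refine (((hc.top X (ctxFormula Γ)).extend FregeRule.mono
        (hc.trans (.inr rfl) (.inl hB))).mono Set.subset_union_right).mono_cost ?_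
      nlinarith
    · rcases hΓ with rfl | hΓ
      · exact absurd (List.prefix_nil.1 hpre) heq
      · exact (hpath Γ hΓ Γ₁ hΓ₁ ⟨hpre, heq⟩).gen hc (fun e he => hX ⟨e, he, rfl⟩) hB
  obtain ⟨Y, -, hY, -, hYlast⟩ := hseg.exists_gen hc hq (Set.mem_insert _ _)
    (fun S hS => (hFctx S hS).imp_right fun h => Finset.mem_coe.2 h) subset_rfl
    (fun B hB => hB.elim)
  have g := ((gZ.trans hY).extend FregeRule.mono
    (hc.discharge (.inr (hYlast A hlast)))).mono Set.subset_union_right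
  obtain ⟨N, hN, hprov⟩ := g.exists_provesIn
  refine ⟨N, hN.trans ?_, hprov⟩
  have hs : 1 ≤ s.length := by
    rcases s with _ | ⟨S, s⟩
    · simp at hlast
    · simp
  generalize s.length = n at *
  generalize logStar i p = L
  calc c * F.card + c * ((6 + 3 * i) * (F.card * L)) + (c + 2 * (c * (3 + 2 * i)) + 1) * n + c
      ≤ c * n + c * ((6 + 3 * i) * (m * L)) + (c + 2 * (c * (3 + 2 * i)) + 1) * n + c * n := by
        gcongr
        · omega
        · exact Nat.le_mul_of_pos_right c hs
    _ = (9 * c + 4 * c * i + 1) * n + (6 * c + 3 * c * i) * (m * L) := by ring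
    _ ≤ 15 * (c + 1) * (i + 1) * n + 15 * (c + 1) * (i + 1) * (m * L) := by
        gcongr
        · nlinarith [Nat.zero_le (c * i)]
        · nlinarith [Nat.zero_le (c * i)]
    _ = 15 * (c + 1) * ((i + 1) * (n + m * L)) := by ring

theorem NestedProvesIn.openings_le {Sch : Finset Formula} {A : Formula} {n m : ℕ}
    (h : NestedProvesIn Sch A n m) : m ≤ n := by
  obtain ⟨s, Δ, hseg, -, rfl⟩ := h
  exact hseg.exists_contexts.1

theorem NestedProvesIn.one_le {Sch : Finset Formula} {A : Formula} {n m : ℕ}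
    (h : NestedProvesIn Sch A n m) : 1 ≤ n := by
  obtain ⟨s, Δ, -, hlast, rfl⟩ := h
  rcases s with _ | ⟨S, s⟩
  · simp at hlast
  · simp

end LukNested

theorem mainTheorem7 (k : ℕ) (hk : 2 ≤ k) (Sch : Finset LukNested.Formula)
    (hSch : LukNested.IsFregeSystem k Sch) :
    (∃ c : ℕ, ∀ (A : LukNested.Formula) (n m : ℕ), LukNested.NestedProvesIn Sch A n m →
      ∃ N : ℕ, N ≤ c * (n * LukNested.alpha n) ∧ LukNested.ProvesIn Sch A N) ∧
    (∀ i : ℕ, ∃ c : ℕ, ∀ (A : LukNested.Formula) (n m : ℕ), LukNested.NestedProvesIn Sch A n m →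
      ∃ N : ℕ, N ≤ c * (n + m * LukNested.logStar i m) ∧
        (2 ≤ m → N ≤ c * (n * (m * LukNested.logStar i m))) ∧
        LukNested.ProvesIn Sch A N) := by
  obtain ⟨c, hc⟩ := hSch.exists_ruleCosts hk
  refine ⟨⟨15 * (c + 1) * 10, fun A n m h => ?_⟩,
    fun i => ⟨15 * (c + 1) * ((i + 1) * 2), fun A n m h => ?_⟩⟩
  -- With `i = α(n)` and `p = n`, the factor `i + 1` is at most `2 * α(n)` and `n + m * logStar i n`
  -- at most `5 * n`, which gives the 10.
  · obtain ⟨N, hN, hprov⟩ := h.exists_provesIn hc (LukNested.alpha n) h.openings_le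
    refine ⟨N, hN.trans ?_, hprov⟩
    have h1 := LukNested.one_le_alpha n h.one_le
    have h2 := LukNested.logStar_alpha_le n
    have h3 := h.openings_le
    calc 15 * (c + 1) * ((LukNested.alpha n + 1) *
          (n + m * LukNested.logStar (LukNested.alpha n) n))
        ≤ 15 * (c + 1) * ((LukNested.alpha n + LukNested.alpha n) * (n + n * 4)) := by gcongr
      _ = 15 * (c + 1) * 10 * (n * LukNested.alpha n) := by ring
  · obtain ⟨N, hN, hprov⟩ := h.exists_provesIn hc i le_rfl
    refine ⟨N, hN.trans ?_, fun hm => hN.trans ?_, hprov⟩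
    · rw [← mul_assoc, mul_assoc (15 * (c + 1)) ((i + 1) * 2), mul_assoc (15 * (c + 1))]
      gcongr
      omega
    · have h1 := LukNested.one_le_logStar i m hm
      have h2 : 1 ≤ m * LukNested.logStar i m := Nat.mul_pos (by omega) h1
      have h3 := h.one_le
      calc 15 * (c + 1) * ((i + 1) * (n + m * LukNested.logStar i m))
          ≤ 15 * (c + 1) * ((i + 1) * (n * (m * LukNested.logStar i m) +
              n * (m * LukNested.logStar i m))) :=
            Nat.mul_le_mul_left _ (Nat.mul_le_mul_left _ (Nat.add_le_add
              (Nat.le_mul_of_pos_right n h2) (Nat.le_mul_of_pos_left _ h3)))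
        _ = 15 * (c + 1) * ((i + 1) * 2) * (n * (m * LukNested.logStar i m)) := by ring
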